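/- Let $f$ be a real function that is increasing (nondecreasing) on $[0,1]$, let $d_0\in(0,1)$, $\theta_0=f(d_0)$, and assume $f\in\mathscr F$: in a neighbourhood of $d_0$, $f$ has a positive continuous first derivative, and its third derivative exists and is uniformly bounded there. (Outside $[0,1]$ the values of $f$ are arbitrary.) Fix $p\in(0,1)$, $K>0$ and $\gamma\in(0,1/3)$. For each total budget $n$ let $n_1=\lfloor np\rfloor$ if $n-\lfloor np\rfloor$ is even and $n_1=\lfloor np\rfloor+1$ otherwise, and let $n_2=(n-n_1)/2$. *Design.* For each $n$ let $x_1<\dots<x_{n_1}$ be points of $[0,1]$ (depending on $n$) such that (A1) holds: there is a distribution function $G$ with a Lebesgue density $g$ such that $G$ is differentiable at $d_0$ with $G'(d_0)=g(d_0)>0$, and $\sup_{x\in[0,1]}|F_n(x)-G(x)|=o(n_1^{-1/3})$ as $n\to\infty$, where $F_n$ is the empirical distribution function of $x_1,\dots,x_{n_1}$. *Errors.* Let $\varepsilon$ be a real random variable with $\mathbb E\varepsilon=0$, $\mathbb E\varepsilon^2=\sigma^2$, $\sigma>0$, and $\mathbb E\varepsilon^6<\infty$. On a probability space $(\Omega,\mathscr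 A,P)$, for each $n$, let $\varepsilon_i,\varepsilon_i',\varepsilon_i''$ $(1\le i\le n)$ (depending on $n$) be independent copies of $\varepsilon$. *Two-stage estimator.* Let $Y_i=f(x_i)+\varepsilon_i$ for $i\le n_1$, let $\hat f$ be an isotonic regression of these data, i.e. a nondecreasing function on $[0,1]$ that minimizes $\sum_{i\le n_1}(Y_i-h(x_i))^2$ over all nondecreasing functions $h$ on $[0,1]$, and let $\hat d_{n_1}^{(1)}=\inf\{x\in[0,1]:\hat f(x)\ge\theta_0\}$. Put $L=\hat d_{n_1}^{(1)}-Kn_1^{-\gamma}$, $U=\hat d_{n_1}^{(1)}+Kn_1^{-\gamma}$, and let $Y_i'=f(L)+\varepsilon_i'$, $Y_i''=f(U)+\varepsilon_i''$ for $i\le n_2$. Let $(\hat\beta_0,\hat\beta_1)$ be the least squares intercept and slope of the data $(L,Y_i'),(U,Y_i'')$, $i\le n_2$, that is, $\hat\beta_1=(2Kn_1^{-\gamma}n_2)^{-1}\sum_{i\le n_2}(Y_i''-Y_i')$ and $\hat\beta_0=(2n_2)^{-1}\sum_{i\le n_2}(Y_i''+Y_i')-\hat d_{n_1}^{(1)}\hat\beta_1$,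 and let $\tilde d_n^{(2)}=(\theta_0-\hat\beta_0)/\hat\beta_1$. *Bootstrap.* Given the data, let $Y_i'^{\star}$ and $Y_i''^{\star}$, $i\le n_2$, be independent samples drawn with replacement from $\{Y_i'\}_{i\le n_2}$ and $\{Y_i''\}_{i\le n_2}$, respectively; let $\tilde d_n^{(2)\star}$ be computed from them by the same formulas, with the same $\hat d_{n_1}^{(1)}$, $L$, $U$; and let $P^\star$ be the probability of the bootstrap samples conditional on the data. Then $$\sup_{t\in\mathbb R}\Bigl|P^\star\bigl(n^{1/2}(\tilde d_n^{(2)\star}-\tilde d_n^{(2)})\le t\bigr)-P(C_2Z_1\le t)\Bigr|\xrightarrow{\;P\;}0\qquad(n\to\infty),$$ where $Z_1$ is standard normal and $C_2=\sigma/[f'(d_0)(1-p)^{1/2}]$. -/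

import Mathlib

open MeasureTheory ProbabilityTheory Filter Topology Asymptotics

noncomputable section

/-! ### The regression function -/

/-- The class `𝓕₀`: `f` is increasing (nondecreasing) on `[0,1]` and has a positive continuous first
derivative in a neighbourhood of `d₀`. Values of `f` outside `[0,1]` are unrestricted. -/
def ClassF0 (d₀ : ℝ) (f : ℝ → ℝ) : Prop :=
  MonotoneOn f (Set.Icc 0 1) ∧
    ∀ᶠ x in 𝓝 d₀, DifferentiableAt ℝ f x ∧ 0 < deriv f x ∧ ContinuousAt (deriv f) x

/-- The class `𝓕`: members of `𝓕₀` whose third derivative exists and is uniformly bounded in a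
neighbourhood of `d₀`. -/
def ClassF (d₀ : ℝ) (f : ℝ → ℝ) : Prop :=
  ClassF0 d₀ f ∧
    ∃ B : ℝ, ∀ᶠ x in 𝓝 d₀, DifferentiableAt ℝ (deriv f) x ∧
      DifferentiableAt ℝ (deriv (deriv f)) x ∧ |deriv (deriv (deriv f)) x| ≤ B

/-! ### Sample sizes -/

/-- First-stage sample size: `⌊np⌋` if `n - ⌊np⌋` is even, and `⌊np⌋ + 1` otherwise. -/
def stageOneSize (p : ℝ) (n : ℕ) : ℕ :=
  if Even (n - ⌊(n : ℝ) * p⌋₊) then ⌊(n : ℝ) * p⌋₊ else ⌊(n : ℝ) * p⌋₊ + 1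

/-- Second-stage sample size at each of the two points: `n = n₁ + 2 n₂`. -/
def stageTwoSize (p : ℝ) (n : ℕ) : ℕ := (n - stageOneSize p n) / 2

/-! ### The first-stage design -/

/-- The empirical distribution function of the points `x 0, …, x (m - 1)`. -/
def empiricalCDF (m : ℕ) (x : ℕ → ℝ) (t : ℝ) : ℝ :=
  (((Finset.range m).filter fun i => x i ≤ t).card : ℝ) / m

/-- The design assumption for a triangular array whose `n`-th row consists of the `m n` points
`x n 0, …, x n (m n - 1)`: there is a distribution function `G` with Lebesgue density `g`, positive
at `d₀`, such that `sup_{t ∈ [0,1]} |F_n(t) - G(t)| = o(m_n^{-1/3})`. As a density is determined only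
almost everywhere, its value at `d₀` is read as the derivative of `G` there. -/
def DesignA1 (m : ℕ → ℕ) (x : ℕ → ℕ → ℝ) (d₀ : ℝ) : Prop :=
  ∃ (ν : Measure ℝ) (g : ℝ → ℝ), IsProbabilityMeasure ν ∧ Measurable g ∧ (∀ t, 0 ≤ g t) ∧
    ν = volume.withDensity (fun t => ENNReal.ofReal (g t)) ∧
    HasDerivAt (cdf ν) (g d₀) d₀ ∧ 0 < g d₀ ∧
    (fun n => ⨆ t : Set.Icc (0 : ℝ) 1, |empiricalCDF (m n) (x n) t - cdf ν t|)
      =o[atTop] fun n => (m n : ℝ) ^ (-(1 / 3) : ℝ)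

/-! ### Isotonic regression and the first-stage estimator -/

/-- `fhat` is an isotonic regression on `[0,1]` of the data `(x i, Y i)`, `i < m`: it minimizes the
residual sum of squares over all nondecreasing functions on `[0,1]`. Its values at the design points
are unique; in between any nondecreasing interpolation is allowed. -/
def IsIsotonicRegression (m : ℕ) (x Y : ℕ → ℝ) (fhat : ℝ → ℝ) : Prop :=
  MonotoneOn fhat (Set.Icc 0 1) ∧
    ∀ h : ℝ → ℝ, MonotoneOn h (Set.Icc 0 1) →
      ∑ i ∈ Finset.range m, (Y i - fhat (x i)) ^ 2 ≤ ∑ i ∈ Finset.range m, (Y i - h (x i)) ^ 2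

/-- The inverse estimate `inf {x ∈ [0,1] : fhat x ≥ θ}`. -/
def inverseAt (fhat : ℝ → ℝ) (θ : ℝ) : ℝ := sInf {x | x ∈ Set.Icc (0 : ℝ) 1 ∧ θ ≤ fhat x}

/-! ### The second-stage estimator

`d` is the first-stage estimate, `h` the half-width, and `y'`, `y''` the responses at `d - h` and
`d + h`, respectively. -/

/-- Least squares slope. -/
def lsSlope {m : ℕ} (h : ℝ) (y' y'' : Fin m → ℝ) : ℝ :=
  (2 * h * m)⁻¹ * ∑ i, (y'' i - y' i)

/-- Least squares intercept. -/
def lsIntercept {m : ℕ} (d h : ℝ) (y' y'' : Fin m → ℝ) : ℝ :=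
  (2 * (m : ℝ))⁻¹ * ∑ i, (y'' i + y' i) - d * lsSlope h y' y''

/-- The two-stage estimator: the point where the fitted line takes the value `θ`. -/
def twoStageEst {m : ℕ} (θ d h : ℝ) (y' y'' : Fin m → ℝ) : ℝ :=
  (θ - lsIntercept d h y' y'') / lsSlope h y' y''

/-! ### The bootstrap -/

/-- The empirical measure of `y`. -/
def empiricalMeasure {m : ℕ} (y : Fin m → ℝ) : Measure ℝ :=
  (m : ENNReal)⁻¹ • ∑ i, Measure.dirac (y i)

/-- `P⋆`, the law of the pair of bootstrap samples given the data: two independent samples of size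
`m`, drawn with replacement from `y'` and from `y''`, respectively. -/
def bootstrapMeasure {m : ℕ} (y' y'' : Fin m → ℝ) : Measure ((Fin m → ℝ) × (Fin m → ℝ)) :=
  (Measure.pi fun _ : Fin m => empiricalMeasure y').prod
    (Measure.pi fun _ : Fin m => empiricalMeasure y'')

/-- `P⋆(n^{1/2} (d̃⋆ - d̃) ≤ t)`. -/
def bootstrapCDF {m : ℕ} (n : ℕ) (θ d h : ℝ) (y' y'' : Fin m → ℝ) (t : ℝ) : ℝ :=
  (bootstrapMeasure y' y'').real
    {q | √(n : ℝ) * (twoStageEst θ d h q.1 q.2 - twoStageEst θ d h y' y'') ≤ t}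

/-! ### Checks of the definitions -/

theorem empiricalMeasure_isProbabilityMeasure {m : ℕ} (hm : m ≠ 0) (y : Fin m → ℝ) :
    IsProbabilityMeasure (empiricalMeasure y) := by
  constructor
  simp [empiricalMeasure]
  exact ENNReal.inv_mul_cancel (by simpa using hm) (by simp)

theorem stageOneSize_add_two_mul (p : ℝ) (hp1 : p < 1) (n : ℕ) :
    stageOneSize p n + 2 * stageTwoSize p n = n := by
  have h : ⌊(n : ℝ) * p⌋₊ ≤ n := by
    apply Nat.floor_le_of_le
    nlinarith [(Nat.cast_nonneg n : (0 : ℝ) ≤ n)]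
  unfold stageTwoSize stageOneSize
  split_ifs with he
  · obtain ⟨k, hk⟩ := he
    omega
  · rw [Nat.not_even_iff_odd] at he
    obtain ⟨k, hk⟩ := he
    omega

theorem sum_sub_mean_sq_le {m : ℕ} (y : Fin m → ℝ) (c : ℝ) :
    ∑ i, (y i - (m : ℝ)⁻¹ * ∑ j, y j) ^ 2 ≤ ∑ i, (y i - c) ^ 2 := by
  rcases Nat.eq_zero_or_pos m with rfl | hm
  · simp
  have hm' : (0 : ℝ) < m := by exact_mod_cast hm
  set s := ∑ j, y j with hs
  have key : ∀ a : ℝ, ∑ i, (y i - a) ^ 2 = ∑ i, y i ^ 2 - 2 * a * s + m * a ^ 2 := by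
    intro a
    simp only [sub_sq, Finset.sum_add_distrib, Finset.sum_sub_distrib, Finset.sum_const,
      Finset.card_univ, Fintype.card_fin, nsmul_eq_mul, hs, Finset.mul_sum]
    congr 2
    exact Finset.sum_congr rfl fun i _ => by ring
  rw [key, key]
  have : s = m * ((m : ℝ)⁻¹ * s) := by field_simp
  set a := (m : ℝ)⁻¹ * s
  rw [this]
  nlinarith [mul_nonneg hm'.le (sq_nonneg (a - c))]

/-- `lsIntercept`, `lsSlope` are the least squares coefficients of the model `y = β₀ + β₁ x`. -/
theorem ls_minimizes {m : ℕ} {h : ℝ} (hh : h ≠ 0) (d : ℝ) (y' y'' : Fin m → ℝ) (b₀ b₁ : ℝ) :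
    ∑ i, ((y' i - lsIntercept d h y' y'' - lsSlope h y' y'' * (d - h)) ^ 2 +
        (y'' i - lsIntercept d h y' y'' - lsSlope h y' y'' * (d + h)) ^ 2) ≤
      ∑ i, ((y' i - b₀ - b₁ * (d - h)) ^ 2 + (y'' i - b₀ - b₁ * (d + h)) ^ 2) := by
  rcases Nat.eq_zero_or_pos m with rfl | hm
  · simp
  have hm' : (m : ℝ) ≠ 0 := by positivity
  have e1 : lsIntercept d h y' y'' + lsSlope h y' y'' * (d - h) = (m : ℝ)⁻¹ * ∑ j, y' j := by
    simp only [lsIntercept, lsSlope, Finset.sum_add_distrib, Finset.sum_sub_distrib]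
    field_simp
    ring
  have e2 : lsIntercept d h y' y'' + lsSlope h y' y'' * (d + h) = (m : ℝ)⁻¹ * ∑ j, y'' j := by
    simp only [lsIntercept, lsSlope, Finset.sum_add_distrib, Finset.sum_sub_distrib]
    field_simp
    ring
  simp only [sub_sub, e1, e2, Finset.sum_add_distrib]
  exact add_le_add (sum_sub_mean_sq_le y' _) (sum_sub_mean_sq_le y'' _)

/-- An isotonic regression exists for every set of data. -/
theorem exists_isIsotonicRegression (m : ℕ) (x Y : ℕ → ℝ) (hx : ∀ i < m, x i ∈ Set.Icc (0 : ℝ) 1) :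
    ∃ fhat, IsIsotonicRegression m x Y fhat := by
  let C : Set (EuclideanSpace ℝ (Fin m)) := {u | ∀ i j : Fin m, x i ≤ x j → u i ≤ u j}
  have hne : C.Nonempty := ⟨0, fun i j _ => le_rfl⟩
  have hcl : IsClosed C := by
    simp only [C, Set.ofPred_forall]
    refine isClosed_iInter fun i => isClosed_iInter fun j => isClosed_iInter fun _ => ?_
    exact isClosed_le (by fun_prop) (by fun_prop)
  have hcv : Convex ℝ C := by
    intro u hu v hv a b ha hb _ i j hij
    have h1 := mul_le_mul_of_nonneg_left (hu i j hij) ha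
    have h2 := mul_le_mul_of_nonneg_left (hv i j hij) hb
    exact add_le_add h1 h2
  let y : EuclideanSpace ℝ (Fin m) := WithLp.toLp 2 fun i => Y i
  obtain ⟨u, huC, hu⟩ := exists_norm_eq_iInf_of_complete_convex hne hcl.isComplete hcv y
  have hmin : ∀ v ∈ C, ‖y - u‖ ≤ ‖y - v‖ := by
    intro v hv
    rw [hu]
    exact ciInf_le ⟨0, by rintro _ ⟨w, rfl⟩; exact norm_nonneg _⟩ (⟨v, hv⟩ : C)
  classical
  let φ : ℝ → ℝ := fun t => if h : ∃ i : Fin m, x i = t then u h.choose else 0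
  have hφ : ∀ i : Fin m, φ (x i) = u i := by
    intro i
    have h : ∃ j : Fin m, x j = x i := ⟨i, rfl⟩
    simp only [φ, dif_pos h]
    exact le_antisymm (huC _ _ h.choose_spec.le) (huC _ _ h.choose_spec.ge)
  have hmono : MonotoneOn φ (Set.range fun i : Fin m => x i) := by
    rintro _ ⟨i, rfl⟩ _ ⟨j, rfl⟩ hij
    simp only [hφ]
    exact huC i j hij
  have hfin : (φ '' Set.range fun i : Fin m => x i).Finite := (Set.finite_range _).image _
  obtain ⟨g, hg, hgφ⟩ := hmono.exists_monotone_extension hfin.bddBelow hfin.bddAbove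
  refine ⟨g, hg.monotoneOn _, fun h hh => ?_⟩
  have hgu : ∀ i : Fin m, g (x i) = u i := fun i => by rw [← hgφ ⟨i, rfl⟩, hφ]
  have hv := hmin (WithLp.toLp 2 fun i => h (x i))
    (fun i j hij => hh (hx i i.2) (hx j j.2) hij)
  rw [← sq_le_sq₀ (norm_nonneg _) (norm_nonneg _), EuclideanSpace.real_norm_sq_eq,
    EuclideanSpace.real_norm_sq_eq] at hv
  simp only [Finset.sum_range]
  simpa [hgu, y] using hv

end

/-! The isotonic fit can miss `d₀` by a multiple of `h = K n₁^(-γ)` only if some long block of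
consecutive first-stage errors, starting near `d₀`, has a large average. Since `γ < 1/3`, the
Hájek–Rényi inequality makes this unlikely, so that the second-stage interval is centred at `d₀` up
to `o(h)`, its least squares slope tends to `f'(d₀)`, and the bias of its midpoint is `o(h)`.

On samples with this behaviour the bootstrap is analysed along arbitrary deterministic sequences.
Where the bootstrapped slope is positive, multiplying by it turns `√n (d̃⋆ - d̃) ≤ t` into an
inequality for a linear combination of the two bootstrap sums, and this obeys a central limit
theorem because no observation dominates its sample. Pólya's theorem makes the convergence uniform
in `t`. -/

/-! ### Row-wise independent, identically distributed, uniformly small summands -/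

theorem norm_cexp_mul_I_sub_taylor_le (x : ℝ) :
    ‖Complex.exp (x * Complex.I) - (1 + x * Complex.I - x ^ 2 / 2)‖ ≤ 4 * |x| ^ 3 := by
  rcases le_or_gt |x| 1 with h | h
  · have htaylor := Complex.norm_exp_sub_sum_le_norm_mul_exp (x * Complex.I) 3
    have hsum : ∑ k ∈ Finset.range 3, ((x : ℂ) * Complex.I) ^ k / (k.factorial : ℂ)
        = 1 + x * Complex.I - x ^ 2 / 2 := by
      simp only [Finset.sum_range_succ, mul_pow, Nat.factorial]
      simp
      ring
    rw [hsum, norm_mul, Complex.norm_I, mul_one, Complex.norm_real, Real.norm_eq_abs] at htaylor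
    calc _ ≤ |x| ^ 3 * Real.exp |x| := htaylor
      _ ≤ |x| ^ 3 * 4 := by
        gcongr
        linarith [Real.exp_le_exp.2 h, Real.exp_one_lt_d9]
      _ = 4 * |x| ^ 3 := mul_comm _ _
  · have hpoly : ‖(1 + x * Complex.I - x ^ 2 / 2 : ℂ)‖ ≤ 1 + |x| + |x| ^ 2 / 2 := by
      refine (norm_sub_le _ _).trans (add_le_add ((norm_add_le _ _).trans ?_) ?_) <;> simp
    refine (norm_sub_le _ _).trans ?_
    rw [Complex.norm_exp_ofReal_mul_I]
    have h1 : |x| ≤ |x| ^ 3 := le_self_pow₀ h.le (by norm_num)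
    have h2 : |x| ^ 2 ≤ |x| ^ 3 := pow_le_pow_right₀ h.le (by norm_num)
    linarith

theorem integral_quadratic_taylor {μ : Measure ℝ} [IsProbabilityMeasure μ]
    (h₁ : Integrable (fun x => x) μ) (h₂ : Integrable (fun x => x ^ 2) μ)
    (hmean : ∫ x, x ∂μ = 0) (t : ℝ) :
    Integrable (fun x : ℝ => 1 + ((t * x : ℝ) : ℂ) * Complex.I - ((t * x : ℝ) : ℂ) ^ 2 / 2) μ ∧
      ∫ x : ℝ, (1 + ((t * x : ℝ) : ℂ) * Complex.I - ((t * x : ℝ) : ℂ) ^ 2 / 2) ∂μ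
        = ((1 - t ^ 2 / 2 * ∫ x, x ^ 2 ∂μ : ℝ) : ℂ) := by
  have hlin : Integrable (fun x : ℝ => ((t * x : ℝ) : ℂ) * Complex.I) μ :=
    (h₁.const_mul t).ofReal.mul_const Complex.I
  have hquad : Integrable (fun x : ℝ => ((t * x : ℝ) : ℂ) ^ 2 / 2) μ :=
    ((h₂.const_mul (t ^ 2 / 2)).ofReal (𝕜 := ℂ)).congr (.of_forall fun x => by simp; ring)
  have haffine : Integrable (fun x : ℝ => 1 + ((t * x : ℝ) : ℂ) * Complex.I) μ :=
    (integrable_const 1).add hlin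
  have hlin0 : ∫ x : ℝ, ((t * x : ℝ) : ℂ) * Complex.I ∂μ = 0 := by
    rw [integral_mul_const, integral_complex_ofReal, integral_const_mul, hmean]
    simp
  have hquad0 : ∫ x : ℝ, ((t * x : ℝ) : ℂ) ^ 2 / 2 ∂μ
      = ((t ^ 2 / 2 * ∫ x, x ^ 2 ∂μ : ℝ) : ℂ) := by
    rw [← integral_const_mul, ← integral_complex_ofReal]
    exact integral_congr_ae (.of_forall fun x => by push_cast; ring)
  refine ⟨haffine.sub hquad, ?_⟩
  rw [integral_sub haffine hquad, integral_add (integrable_const 1) hlin, hlin0, hquad0]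
  simp

theorem norm_charFun_sub_le {μ : Measure ℝ} [IsProbabilityMeasure μ] {B : ℝ}
    (hB : ∀ᵐ x ∂μ, |x| ≤ B) (hmean : ∫ x, x ∂μ = 0) (t : ℝ) :
    ‖charFun μ t - (1 - t ^ 2 / 2 * ∫ x, x ^ 2 ∂μ : ℝ)‖ ≤ 4 * |t| ^ 3 * B * ∫ x, x ^ 2 ∂μ := by
  have h₁ : Integrable (fun x : ℝ => x) μ := .of_bound (by fun_prop) B hB
  have h₂ : Integrable (fun x : ℝ => x ^ 2) μ :=
    .of_bound (by fun_prop) (B ^ 2) (hB.mono fun x hx => by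
      rw [norm_pow]
      exact pow_le_pow_left₀ (norm_nonneg x) hx 2)
  have hexp : Integrable (fun x : ℝ => Complex.exp ((t * x : ℝ) * Complex.I)) μ :=
    .of_bound (by fun_prop) 1 (.of_forall fun x => (Complex.norm_exp_ofReal_mul_I _).le)
  obtain ⟨hpoly_int, hpoly⟩ := integral_quadratic_taylor h₁ h₂ hmean t
  have hchar : charFun μ t = ∫ x : ℝ, Complex.exp ((t * x : ℝ) * Complex.I) ∂μ := by
    simp [charFun_apply_real]
  rw [hchar, ← hpoly, ← integral_sub hexp hpoly_int, ← integral_const_mul]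
  refine norm_integral_le_of_norm_le (h₂.const_mul _) (hB.mono fun x hx => ?_)
  calc _ ≤ 4 * |t * x| ^ 3 := norm_cexp_mul_I_sub_taylor_le _
    _ = 4 * |t| ^ 3 * |x| * x ^ 2 := by rw [abs_mul, ← sq_abs x]; ring
    _ ≤ 4 * |t| ^ 3 * B * x ^ 2 := by gcongr

theorem tendsto_one_add_pow_cexp {ι : Type*} {l : Filter ι} {m : ι → ℕ} {g : ι → ℂ} {t : ℂ}
    (hg : Tendsto g l (𝓝 0)) (hmg : Tendsto (fun k => m k * g k) l (𝓝 t)) :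
    Tendsto (fun k => (1 + g k) ^ m k) l (𝓝 (Complex.exp t)) := by
  have hlog : Tendsto (fun k => m k * Complex.log (1 + g k)) l (𝓝 t) := by
    have hO : (fun k => m k * (Complex.log (1 + g k) - g k)) =O[l] fun k => m k * g k * g k :=
      ((isBigO_refl (fun k => (m k : ℂ)) l).mul
        (Complex.log_sub_self_isBigO.comp_tendsto hg)).congr_right
        fun k => by simp only [Function.comp_apply]; ring
    have hrem := hO.trans_tendsto (by simpa using hmg.mul hg)
    simpa using (hrem.add hmg).congr fun k => by ring
  refine ((Complex.continuous_exp.tendsto t).comp hlog).congr' ?_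
  filter_upwards [hg.eventually_ne (show (0 : ℂ) ≠ -1 by simp)] with k hk
  have hne : 1 + g k ≠ 0 := fun h => hk (eq_neg_of_add_eq_zero_right h)
  rw [Function.comp_apply, Complex.exp_nat_mul, Complex.exp_log hne]

theorem tendsto_charFun_pow {ι : Type*} {l : Filter ι} {m : ι → ℕ} {μ : ι → Measure ℝ}
    [∀ k, IsProbabilityMeasure (μ k)] {B : ι → ℝ} {V : ℝ} (hbound : ∀ k, ∀ᵐ x ∂μ k, |x| ≤ B k)
    (hB : Tendsto B l (𝓝 0)) (hmean : ∀ k, ∫ x, x ∂μ k = 0)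
    (hV : Tendsto (fun k => m k * ∫ x, x ^ 2 ∂μ k) l (𝓝 V)) (t : ℝ) :
    Tendsto (fun k => charFun (μ k) t ^ m k) l (𝓝 (Complex.exp (-(V * t ^ 2 / 2) : ℝ))) := by
  let v : ι → ℝ := fun k => ∫ x, x ^ 2 ∂μ k
  let rem : ι → ℂ := fun k => charFun (μ k) t - (1 - t ^ 2 / 2 * v k : ℝ)
  have hsmall : Tendsto v l (𝓝 0) := by
    refine squeeze_zero (fun k => integral_nonneg fun x => sq_nonneg x) (fun k => ?_)
      (by simpa using hB.pow 2)
    have hle : ∀ᵐ x ∂μ k, x ^ 2 ≤ B k ^ 2 := (hbound k).mono fun x hx => sq_le_sq' (abs_le.1 hx).1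
      (abs_le.1 hx).2
    calc v k ≤ ∫ _, B k ^ 2 ∂μ k :=
          integral_mono_of_nonneg (.of_forall fun x => sq_nonneg x) (integrable_const _) hle
      _ = B k ^ 2 := by simp
  have hrem : ∀ k, ‖rem k‖ ≤ 4 * |t| ^ 3 * B k * v k := fun k =>
    norm_charFun_sub_le (hbound k) (hmean k) t
  have hrem0 : Tendsto rem l (𝓝 0) :=
    squeeze_zero_norm hrem (by simpa using (hB.const_mul (4 * |t| ^ 3)).mul hsmall)
  have hmrem : Tendsto (fun k => m k * rem k) l (𝓝 0) := by
    refine squeeze_zero_norm (fun k => ?_) (by simpa using (hB.const_mul (4 * |t| ^ 3)).mul hV)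
    calc ‖m k * rem k‖ = m k * ‖rem k‖ := by simp
      _ ≤ m k * (4 * |t| ^ 3 * B k * v k) := by gcongr; exact hrem k
      _ = 4 * |t| ^ 3 * B k * (m k * v k) := by ring
  have hg0 : Tendsto (fun k => rem k - (t ^ 2 / 2 * v k : ℝ)) l (𝓝 0) := by
    have hquad0 : Tendsto (fun k => ((t ^ 2 / 2 * v k : ℝ) : ℂ)) l (𝓝 ((t ^ 2 / 2 * 0 : ℝ) : ℂ)) :=
      (Complex.continuous_ofReal.tendsto _).comp (hsmall.const_mul (t ^ 2 / 2))
    simpa using hrem0.sub hquad0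
  have hmg : Tendsto (fun k => m k * (rem k - (t ^ 2 / 2 * v k : ℝ))) l
      (𝓝 ((-(V * t ^ 2 / 2) : ℝ) : ℂ)) := by
    rw [show ((-(V * t ^ 2 / 2) : ℝ) : ℂ) = 0 - ((t ^ 2 / 2 * V : ℝ) : ℂ) by push_cast; ring]
    have hmain : Tendsto (fun k => ((t ^ 2 / 2 * (m k * v k) : ℝ) : ℂ)) l
        (𝓝 ((t ^ 2 / 2 * V : ℝ) : ℂ)) := (hV.const_mul (t ^ 2 / 2)).ofReal
    exact (hmrem.sub hmain).congr fun k => by push_cast; ring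
  refine (tendsto_one_add_pow_cexp hg0 hmg).congr fun k => ?_
  simp only [rem]
  push_cast
  ring

/-! ### The bootstrap central limit theorem -/

/-- The sample mean. -/
noncomputable def sampleMean {m : ℕ} (y : Fin m → ℝ) : ℝ := (m : ℝ)⁻¹ * ∑ i, y i

/-- The sample variance, normalized by the sample size as it is the variance of a bootstrap draw. -/
noncomputable def sampleVar {m : ℕ} (y : Fin m → ℝ) : ℝ :=
  (m : ℝ)⁻¹ * ∑ i, (y i - sampleMean y) ^ 2

/-- The largest distance of an observation from the sample mean. That it is of smaller order than
the root of the sample size is the Noether condition for the bootstrap central limit theorem. -/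
noncomputable def sampleMaxDev {m : ℕ} (y : Fin m → ℝ) : ℝ := ‖fun i => y i - sampleMean y‖

theorem sum_sub_sampleMean {m : ℕ} [NeZero m] (y : Fin m → ℝ) :
    ∑ i, (y i - sampleMean y) = 0 := by
  have hm : (m : ℝ) ≠ 0 := NeZero.ne _
  simp [sampleMean, Finset.sum_sub_distrib, hm]

instance {m : ℕ} [NeZero m] (y : Fin m → ℝ) : IsProbabilityMeasure (empiricalMeasure y) :=
  empiricalMeasure_isProbabilityMeasure (NeZero.ne m) y

instance {m : ℕ} [NeZero m] (y' y'' : Fin m → ℝ) :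
    IsProbabilityMeasure (bootstrapMeasure y' y'') := by
  unfold bootstrapMeasure
  infer_instance

theorem integral_empiricalMeasure {E : Type*} [NormedAddCommGroup E] [NormedSpace ℝ E]
    [CompleteSpace E] {m : ℕ} (y : Fin m → ℝ) (g : ℝ → E) :
    ∫ z, g z ∂(empiricalMeasure y) = (m : ℝ)⁻¹ • ∑ i, g (y i) := by
  rw [empiricalMeasure, integral_smul_measure,
    integral_finsetSum_measure fun i _ => integrable_dirac (by simp)]
  simp

theorem ae_empiricalMeasure {m : ℕ} {y : Fin m → ℝ} {p : ℝ → Prop} (h : ∀ i, p (y i)) :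
    ∀ᵐ z ∂(empiricalMeasure y), p z := by
  refine Measure.ae_smul_measure (ae_finsetSum_measure_iff.2 fun i _ => ?_) _
  rw [ae_dirac_eq]
  exact h i

theorem tendsto_charFun_empiricalMeasure_pow {m : ℕ → ℕ} [∀ k, NeZero (m k)]
    {y : (k : ℕ) → Fin (m k) → ℝ} {c : ℕ → ℝ} {τ V : ℝ}
    (hc : Tendsto (fun k => c k ^ 2 * m k) atTop (𝓝 τ))
    (hV : Tendsto (fun k => sampleVar (y k)) atTop (𝓝 V))
    (hmax : Tendsto (fun k => sampleMaxDev (y k) / √(m k)) atTop (𝓝 0)) (s : ℝ) :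
    Tendsto (fun k =>
        charFun (empiricalMeasure fun i => c k * (y k i - sampleMean (y k))) s ^ m k) atTop
      (𝓝 (Complex.exp (-(τ * V * s ^ 2 / 2) : ℝ))) := by
  have hm : ∀ k, (m k : ℝ) ≠ 0 := fun k => NeZero.ne _
  refine tendsto_charFun_pow (B := fun k => |c k| * sampleMaxDev (y k))
    (fun k => ae_empiricalMeasure fun i => ?_) ?_ (fun k => ?_) ?_ s
  · rw [abs_mul]
    gcongr
    exact norm_le_pi_norm (fun i => y k i - sampleMean (y k)) i
  · have := hc.sqrt.mul hmax
    rw [mul_zero] at this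
    refine this.congr fun k => ?_
    rw [Real.sqrt_mul (sq_nonneg _), Real.sqrt_sq_eq_abs]
    have := hm k
    field_simp
  · rw [integral_empiricalMeasure, ← Finset.mul_sum, sum_sub_sampleMean]
    simp
  · refine (hc.mul hV).congr fun k => ?_
    simp only [integral_empiricalMeasure, sampleVar, mul_pow, ← Finset.mul_sum, smul_eq_mul]
    ring

/-- A linear combination of the centered sums of the two bootstrap samples. -/
noncomputable def bootLin {m : ℕ} (y' y'' : Fin m → ℝ) (c c' : ℝ)
    (q : (Fin m → ℝ) × (Fin m → ℝ)) : ℝ :=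
  c * ∑ i, (q.1 i - sampleMean y') + c' * ∑ i, (q.2 i - sampleMean y'')

theorem measurable_bootLin {m : ℕ} (y' y'' : Fin m → ℝ) (c c' : ℝ) :
    Measurable (bootLin y' y'' c c') := by
  unfold bootLin
  fun_prop

theorem charFun_map_bootLin {m : ℕ} [NeZero m] (y' y'' : Fin m → ℝ) (c c' s : ℝ) :
    charFun ((bootstrapMeasure y' y'').map (bootLin y' y'' c c')) s
      = charFun (empiricalMeasure fun i => c * (y' i - sampleMean y')) s ^ m *
        charFun (empiricalMeasure fun i => c' * (y'' i - sampleMean y'')) s ^ m := by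
  have hpow : ∀ (y : Fin m → ℝ) (c : ℝ),
      ∫ q : Fin m → ℝ, ∏ i, Complex.exp (s * (c * (q i - sampleMean y) : ℝ) * Complex.I)
        ∂(Measure.pi fun _ => empiricalMeasure y)
        = charFun (empiricalMeasure fun i => c * (y i - sampleMean y)) s ^ m := by
    intro y c
    rw [integral_fintype_prod_eq_pow (μ := empiricalMeasure y)
      (fun z => Complex.exp (s * (c * (z - sampleMean y) : ℝ) * Complex.I)),
      charFun_apply_real, integral_empiricalMeasure, integral_empiricalMeasure, Fintype.card_fin]
  rw [charFun_apply_real, integral_map (measurable_bootLin ..).aemeasurable (by fun_prop),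
    ← hpow y', ← hpow y'', bootstrapMeasure, ← integral_prod_mul]
  refine integral_congr_ae (.of_forall fun q => ?_)
  simp only [bootLin, ← Complex.exp_sum, ← Complex.exp_add]
  congr 1
  push_cast
  simp only [← Finset.sum_mul, ← Finset.mul_sum]
  ring

theorem tendsto_real_bootLin_le {m : ℕ → ℕ} [∀ k, NeZero (m k)]
    {y' y'' : (k : ℕ) → Fin (m k) → ℝ} {c c' : ℕ → ℝ} {τ τ' V : ℝ}
    (hc : Tendsto (fun k => c k ^ 2 * m k) atTop (𝓝 τ))
    (hc' : Tendsto (fun k => c' k ^ 2 * m k) atTop (𝓝 τ'))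
    (hV' : Tendsto (fun k => sampleVar (y' k)) atTop (𝓝 V))
    (hV'' : Tendsto (fun k => sampleVar (y'' k)) atTop (𝓝 V))
    (hmax' : Tendsto (fun k => sampleMaxDev (y' k) / √(m k)) atTop (𝓝 0))
    (hmax'' : Tendsto (fun k => sampleMaxDev (y'' k) / √(m k)) atTop (𝓝 0))
    {x : ℝ} (hx : gaussianReal 0 ((τ + τ') * V).toNNReal {x} = 0) :
    Tendsto (fun k => (bootstrapMeasure (y' k) (y'' k)).real
        {q | bootLin (y' k) (y'' k) (c k) (c' k) q ≤ x}) atTop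
      (𝓝 ((gaussianReal 0 ((τ + τ') * V).toNNReal).real (Set.Iic x))) := by
  have hV0 : 0 ≤ (τ + τ') * V := by
    refine ge_of_tendsto' ((hc.add hc').mul hV') fun k => ?_
    unfold sampleVar
    positivity
  let μ : ℕ → ProbabilityMeasure ℝ := fun k =>
    ⟨(bootstrapMeasure (y' k) (y'' k)).map (bootLin (y' k) (y'' k) (c k) (c' k)),
      Measure.isProbabilityMeasure_map (measurable_bootLin ..).aemeasurable⟩
  let μ₀ : ProbabilityMeasure ℝ := ⟨gaussianReal 0 ((τ + τ') * V).toNNReal, inferInstance⟩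
  have hlim : Tendsto μ atTop (𝓝 μ₀) := by
    rw [ProbabilityMeasure.tendsto_iff_tendsto_charFun]
    intro s
    have hgauss : charFun (μ₀ : Measure ℝ) s = Complex.exp (-(τ * V * s ^ 2 / 2) : ℝ)
        * Complex.exp (-(τ' * V * s ^ 2 / 2) : ℝ) := by
      rw [show (μ₀ : Measure ℝ) = gaussianReal 0 ((τ + τ') * V).toNNReal from rfl,
        charFun_gaussianReal, Real.coe_toNNReal _ hV0, ← Complex.exp_add]
      congr 1
      push_cast
      ring
    rw [hgauss]
    exact ((tendsto_charFun_empiricalMeasure_pow hc hV' hmax' s).mul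
      (tendsto_charFun_empiricalMeasure_pow hc' hV'' hmax'' s)).congr fun k =>
        (charFun_map_bootLin ..).symm
  have hfrontier : (μ₀ : Measure ℝ) (frontier (Set.Iic x)) = 0 := by
    rw [frontier_Iic]
    exact hx
  refine ((ENNReal.tendsto_toReal (measure_ne_top (μ₀ : Measure ℝ) _)).comp
    (ProbabilityMeasure.tendsto_measure_of_null_frontier_of_tendsto' hlim hfrontier)).congr
    fun k => ?_
  exact congrArg ENNReal.toReal (Measure.map_apply (measurable_bootLin ..) measurableSet_Iic)

/-! ### Pólya's theorem -/

theorem abs_sub_lt_of_monotone {F Φ : ℝ → ℝ} (hF : Monotone F) (hΦ : Monotone Φ) {a b t η : ℝ}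
    (ht : t ∈ Set.Icc a b) (hab : Φ b - Φ a < η) (ha : |F a - Φ a| < η) (hb : |F b - Φ b| < η) :
    |F t - Φ t| < 2 * η := by
  rw [abs_lt] at *
  constructor <;> linarith [hF ht.1, hF ht.2, hΦ ht.1, hΦ ht.2]

theorem tendstoLocallyUniformly_of_monotone {ι : Type*} {l : Filter ι} {F : ι → ℝ → ℝ} {Φ : ℝ → ℝ}
    (hF : ∀ k, Monotone (F k)) (hΦ : Monotone Φ) (hΦc : Continuous Φ)
    (hlim : ∀ t, Tendsto (fun k => F k t) l (𝓝 (Φ t))) : TendstoLocallyUniformly F Φ l := by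
  rw [Metric.tendstoLocallyUniformly_iff]
  intro η hη t
  have hpt : ∀ t, ∀ᶠ k in l, |F k t - Φ t| < η / 2 := fun t =>
    Metric.tendsto_nhds.1 (hlim t) _ (half_pos hη)
  have hosc : ∀ᶠ δ in 𝓝[>] (0 : ℝ), Φ (t + δ) - Φ (t - δ) < η / 2 := by
    have hlim0 : Tendsto (fun δ => Φ (t + δ) - Φ (t - δ)) (𝓝 0) (𝓝 0) := by
      have : Continuous fun δ => Φ (t + δ) - Φ (t - δ) := by fun_prop
      simpa using this.tendsto 0
    exact nhdsWithin_le_nhds (hlim0.eventually_lt_const (half_pos hη))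
  obtain ⟨δ, hδ, hδ0⟩ := (hosc.and self_mem_nhdsWithin).exists
  refine ⟨Set.Icc (t - δ) (t + δ),
    Icc_mem_nhds (sub_lt_self t hδ0) (lt_add_of_pos_right t hδ0), ?_⟩
  filter_upwards [hpt (t - δ), hpt (t + δ)] with k hleft hright u hu
  rw [dist_comm, Real.dist_eq]
  exact (abs_sub_lt_of_monotone (hF k) hΦ hu hδ hleft hright).trans_eq (by ring)

theorem tendsto_iSup_abs_sub_of_monotone {ι : Type*} {l : Filter ι} {F : ι → ℝ → ℝ} {Φ : ℝ → ℝ}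
    (hF : ∀ k, Monotone (F k)) (hF01 : ∀ k t, F k t ∈ Set.Icc 0 1)
    (hΦ : Monotone Φ) (hΦc : Continuous Φ) (hbot : Tendsto Φ atBot (𝓝 0))
    (htop : Tendsto Φ atTop (𝓝 1)) (hlim : ∀ t, Tendsto (fun k => F k t) l (𝓝 (Φ t))) :
    Tendsto (fun k => ⨆ t, |F k t - Φ t|) l (𝓝 0) := by
  have hΦ01 : ∀ t, Φ t ∈ Set.Icc 0 1 := fun t => ⟨hΦ.le_of_tendsto hbot t, hΦ.ge_of_tendsto htop t⟩
  rw [Metric.tendsto_nhds]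
  intro η hη
  obtain ⟨a, ha⟩ := (hbot.eventually_lt_const (by positivity : 0 < η / 4)).exists
  obtain ⟨b, hb⟩ := (htop.eventually_const_lt (by linarith : 1 - η / 4 < 1)).exists
  have hloc := tendstoLocallyUniformly_of_monotone hF hΦ hΦc hlim
  have hK := tendstoLocallyUniformly_iff_forall_isCompact.1 hloc (Set.uIcc a b) isCompact_uIcc
  filter_upwards [Metric.tendstoUniformlyOn_iff.1 hK (η / 4) (by positivity)] with k hk
  simp only [dist_comm (Φ _), Real.dist_eq] at hk
  have hka := abs_lt.1 (hk a Set.left_mem_uIcc)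
  have hkb := abs_lt.1 (hk b Set.right_mem_uIcc)
  have hsup : ⨆ t, |F k t - Φ t| ≤ η / 2 := by
    refine ciSup_le fun t => ?_
    rcases le_total t a with hta | hta
    · rw [abs_le]
      constructor <;> linarith [hF k hta, hΦ hta, (hF01 k t).1, (hΦ01 t).1]
    rcases le_total b t with hbt | hbt
    · rw [abs_le]
      constructor <;> linarith [hF k hbt, hΦ hbt, (hF01 k t).2, (hΦ01 t).2]
    · linarith [hk t (Set.Icc_subset_uIcc ⟨hta, hbt⟩)]
  rw [Real.dist_0_eq_abs, abs_of_nonneg (Real.iSup_nonneg fun t => abs_nonneg _)]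
  linarith

theorem continuous_cdf (μ : Measure ℝ) [IsProbabilityMeasure μ] [NullSingletonClass μ] :
    Continuous (cdf μ) := by
  refine continuous_iff_continuousAt.2 fun a => ?_
  rw [(monotone_cdf μ).continuousAt_iff_leftLim_eq_rightLim, StieltjesFunction.rightLim_eq]
  refine le_antisymm ((monotone_cdf μ).leftLim_le le_rfl) ?_
  have hjump := StieltjesFunction.measure_singleton (cdf μ) a
  rw [measure_cdf, measure_singleton, eq_comm, ENNReal.ofReal_eq_zero] at hjump
  linarith

/-! ### Linearization of the bootstrapped estimator -/

theorem lsSlope_eq {m : ℕ} (h : ℝ) (y' y'' : Fin m → ℝ) :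
    lsSlope h y' y'' = (sampleMean y'' - sampleMean y') / (2 * h) := by
  rw [lsSlope, sampleMean, sampleMean, Finset.sum_sub_distrib, mul_inv]
  ring

theorem twoStageEst_eq {m : ℕ} {θ d h : ℝ} {y' y'' : Fin m → ℝ} (hβ : lsSlope h y' y'' ≠ 0) :
    twoStageEst θ d h y' y''
      = (θ - (sampleMean y' + sampleMean y'') / 2) / lsSlope h y' y'' + d := by
  have hint : lsIntercept d h y' y''
      = (sampleMean y' + sampleMean y'') / 2 - d * lsSlope h y' y'' := by
    rw [lsIntercept, sampleMean, sampleMean, Finset.sum_add_distrib, mul_inv]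
    ring
  rw [twoStageEst, hint]
  field_simp
  ring

theorem sampleMean_eq_add {m : ℕ} [NeZero m] (q : Fin m → ℝ) (a : ℝ) :
    sampleMean q = a + (m : ℝ)⁻¹ * ∑ i, (q i - a) := by
  have hm : (m : ℝ) ≠ 0 := NeZero.ne _
  simp only [sampleMean, Finset.sum_sub_distrib, Finset.sum_const, Finset.card_univ,
    Fintype.card_fin, nsmul_eq_mul, mul_sub, inv_mul_cancel_left₀ hm]
  ring

theorem lsSlope_eq_add_bootLin {m : ℕ} [NeZero m] (h : ℝ) (y' y'' : Fin m → ℝ)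
    (q : (Fin m → ℝ) × (Fin m → ℝ)) :
    lsSlope h q.1 q.2 = lsSlope h y' y'' +
      bootLin y' y'' (-(1 / (2 * h * m))) (1 / (2 * h * m)) q := by
  rw [lsSlope_eq, lsSlope_eq, sampleMean_eq_add q.1 (sampleMean y'),
    sampleMean_eq_add q.2 (sampleMean y''), bootLin]
  field_simp
  ring

theorem sampleMean_add_eq_add_bootLin {m : ℕ} [NeZero m] (y' y'' : Fin m → ℝ)
    (q : (Fin m → ℝ) × (Fin m → ℝ)) :
    (sampleMean q.1 + sampleMean q.2) / 2 = (sampleMean y' + sampleMean y'') / 2 +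
      bootLin y' y'' (1 / (2 * m)) (1 / (2 * m)) q := by
  rw [sampleMean_eq_add q.1 (sampleMean y'), sampleMean_eq_add q.2 (sampleMean y''), bootLin]
  ring

/-- The relative difference by which the two bootstrap samples enter the linearized estimator with
different weights. -/
noncomputable def bootCorr {m : ℕ} (r θ h : ℝ) (y' y'' : Fin m → ℝ) (t : ℝ) : ℝ :=
  t / (r * h) + (θ - (sampleMean y' + sampleMean y'') / 2) / h / lsSlope h y' y''

-- Multiplying by the bootstrapped slope turns the event for the ratio `twoStageEst` into one for a
-- linear combination of the two samples; no Taylor remainder arises.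
theorem mul_twoStageEst_sub_le_iff {m : ℕ} [NeZero m] {r θ d h t : ℝ} (hr : r ≠ 0) (hh : h ≠ 0)
    {y' y'' : Fin m → ℝ} {q : (Fin m → ℝ) × (Fin m → ℝ)}
    (hβ : 0 < lsSlope h y' y'') (hq : 0 < lsSlope h q.1 q.2) :
    r * (twoStageEst θ d h q.1 q.2 - twoStageEst θ d h y' y'') ≤ t ↔
      bootLin y' y'' (-(r / (2 * m * lsSlope h y' y'')) * (1 - bootCorr r θ h y' y'' t))
        (-(r / (2 * m * lsSlope h y' y'')) * (1 + bootCorr r θ h y' y'' t)) q ≤ t := by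
  have hm : (m : ℝ) ≠ 0 := NeZero.ne _
  have hslope := lsSlope_eq_add_bootLin h y' y'' q
  rw [twoStageEst_eq hβ.ne', twoStageEst_eq hq.ne', sampleMean_add_eq_add_bootLin y' y'' q]
  unfold bootLin bootCorr at *
  generalize ∑ i, (q.1 i - sampleMean y') = S' at *
  generalize ∑ i, (q.2 i - sampleMean y'') = S'' at *
  generalize lsSlope h q.1 q.2 = b' at *
  generalize lsSlope h y' y'' = b at *
  generalize (sampleMean y' + sampleMean y'') / 2 = a at *
  set A := θ - (a + (1 / (2 * m) * S' + 1 / (2 * m) * S'')) with hA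
  have hratio : r * (A / b' + d - ((θ - a) / b + d)) - t
      = (r * A - b' * (t + r * (θ - a) / b)) / b' := by
    field_simp
    ring
  have hlin : (-(r / (2 * m * b)) * (1 - (t / (r * h) + (θ - a) / h / b))) * S'
      + (-(r / (2 * m * b)) * (1 + (t / (r * h) + (θ - a) / h / b))) * S'' - t
      = (r * A - b' * (t + r * (θ - a) / b)) / b := by
    rw [hA, hslope]
    field_simp
    ring
  rw [← sub_nonpos, hratio, ← sub_nonpos (b := t), hlin, div_le_iff₀ hq, div_le_iff₀ hβ, zero_mul,
    zero_mul]

theorem bootLin_le_neg_one_of_lsSlope_nonpos {m : ℕ} [NeZero m] {h : ℝ}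
    {y' y'' : Fin m → ℝ} {q : (Fin m → ℝ) × (Fin m → ℝ)}
    (hβ : 0 < lsSlope h y' y'') (hq : lsSlope h q.1 q.2 ≤ 0) :
    bootLin y' y'' (-(1 / (2 * h * m * lsSlope h y' y''))) (1 / (2 * h * m * lsSlope h y' y'')) q
      ≤ -1 := by
  rw [lsSlope_eq_add_bootLin h y' y'' q] at hq
  have hscale : bootLin y' y'' (-(1 / (2 * h * m * lsSlope h y' y'')))
      (1 / (2 * h * m * lsSlope h y' y'')) q
        = bootLin y' y'' (-(1 / (2 * h * m))) (1 / (2 * h * m)) q / lsSlope h y' y'' := by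
    simp only [bootLin, ← div_div (1 : ℝ)]
    ring
  rw [hscale, div_le_iff₀ hβ]
  linarith

/-! ### Convergence of the bootstrap distribution function -/

/-- Second-stage responses `y' k`, `y'' k` at distance `2 * h k` with the asymptotic behaviour, for
a target value `θ`, of responses at two points that close in on the target from both sides. They
determine slope `β` and error variance `V`. -/
structure StageTwoRegular {m : ℕ → ℕ} (y' y'' : (k : ℕ) → Fin (m k) → ℝ) (h : ℕ → ℝ)
    (θ β V : ℝ) : Prop where
  slope : Tendsto (fun k => lsSlope (h k) (y' k) (y'' k)) atTop (𝓝 β)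
  bias : Tendsto (fun k => (θ - (sampleMean (y' k) + sampleMean (y'' k)) / 2) / h k) atTop (𝓝 0)
  var_left : Tendsto (fun k => sampleVar (y' k)) atTop (𝓝 V)
  var_right : Tendsto (fun k => sampleVar (y'' k)) atTop (𝓝 V)
  max_left : Tendsto (fun k => sampleMaxDev (y' k) / √(m k)) atTop (𝓝 0)
  max_right : Tendsto (fun k => sampleMaxDev (y'' k) / √(m k)) atTop (𝓝 0)

namespace StageTwoRegular

variable {m : ℕ → ℕ} {y' y'' : (k : ℕ) → Fin (m k) → ℝ} {h r : ℕ → ℝ}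
  {θ β V R : ℝ}

theorem tendsto_bootCorr (hreg : StageTwoRegular y' y'' h θ β V) (hβ : 0 < β)
    (hrh : Tendsto (fun k => r k * h k) atTop atTop) (t : ℝ) :
    Tendsto (fun k => bootCorr (r k) θ (h k) (y' k) (y'' k) t) atTop (𝓝 0) := by
  have := (hrh.const_div_atTop t).add (hreg.bias.div hreg.slope hβ.ne')
  rwa [zero_div, add_zero] at this

variable [∀ k, NeZero (m k)]

theorem tendsto_weight_sq_mul (hreg : StageTwoRegular y' y'' h θ β V) (hβ : 0 < β)
    (hR : Tendsto (fun k => r k ^ 2 / m k) atTop (𝓝 R)) :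
    Tendsto (fun k => (r k / (2 * m k * lsSlope (h k) (y' k) (y'' k))) ^ 2 * m k) atTop
      (𝓝 (R / (4 * β ^ 2))) := by
  refine (hR.div ((hreg.slope.pow 2).const_mul 4) (by positivity)).congr fun k => ?_
  have hm : (m k : ℝ) ≠ 0 := NeZero.ne _
  rw [Pi.div_apply, div_pow, mul_pow, mul_pow]
  field_simp
  ring

theorem tendsto_real_lsSlope_nonpos (hreg : StageTwoRegular y' y'' h θ β V) (hβ : 0 < β)
    (hR : Tendsto (fun k => r k ^ 2 / m k) atTop (𝓝 R))
    (hrh : Tendsto (fun k => r k * h k) atTop atTop) :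
    Tendsto (fun k => (bootstrapMeasure (y' k) (y'' k)).real {q | lsSlope (h k) q.1 q.2 ≤ 0})
      atTop (𝓝 0) := by
  have hweight : Tendsto
      (fun k => (1 / (2 * h k * m k * lsSlope (h k) (y' k) (y'' k))) ^ 2 * m k) atTop (𝓝 0) := by
    have := (hreg.tendsto_weight_sq_mul hβ hR).mul ((tendsto_inv_atTop_zero.comp hrh).pow 2)
    rw [zero_pow two_ne_zero, mul_zero] at this
    refine this.congr' ?_
    filter_upwards [hrh.eventually_gt_atTop 0] with k hk
    obtain ⟨hr0, hh0⟩ := mul_ne_zero_iff.1 hk.ne'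
    simp only [Function.comp_apply]
    field_simp
  have hlin := tendsto_real_bootLin_le (x := -1)
    (c := fun k => -(1 / (2 * h k * m k * lsSlope (h k) (y' k) (y'' k))))
    (by simpa only [neg_sq] using hweight) hweight hreg.var_left hreg.var_right hreg.max_left
    hreg.max_right (by simp)
  have hzero : (gaussianReal 0 ((0 + 0) * V).toNNReal).real (Set.Iic (-1)) = 0 := by
    simp [measureReal_def, Measure.dirac_apply' _ measurableSet_Iic]
  rw [hzero] at hlin
  refine squeeze_zero' (.of_forall fun _ => measureReal_nonneg) ?_ hlin
  filter_upwards [hreg.slope.eventually_const_lt hβ] with k hk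
  exact measureReal_mono fun q hq => bootLin_le_neg_one_of_lsSlope_nonpos hk hq

theorem tendsto_real_linearized_le (hreg : StageTwoRegular y' y'' h θ β V) (hβ : 0 < β)
    (hR : Tendsto (fun k => r k ^ 2 / m k) atTop (𝓝 R)) (hRV : 0 < R * V)
    (hrh : Tendsto (fun k => r k * h k) atTop atTop) (t : ℝ) :
    Tendsto (fun k => (bootstrapMeasure (y' k) (y'' k)).real
        {q | bootLin (y' k) (y'' k)
          (-(r k / (2 * m k * lsSlope (h k) (y' k) (y'' k)))
            * (1 - bootCorr (r k) θ (h k) (y' k) (y'' k) t))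
          (-(r k / (2 * m k * lsSlope (h k) (y' k) (y'' k)))
            * (1 + bootCorr (r k) θ (h k) (y' k) (y'' k) t)) q ≤ t}) atTop
      (𝓝 ((gaussianReal 0 (R / (2 * β ^ 2) * V).toNNReal).real (Set.Iic t))) := by
  have hweight := hreg.tendsto_weight_sq_mul hβ hR
  have hcorr := hreg.tendsto_bootCorr hβ hrh t
  have hsum : R / (2 * β ^ 2) * V = (R / (4 * β ^ 2) + R / (4 * β ^ 2)) * V := by
    field_simp
    ring
  have hne : (R / (2 * β ^ 2) * V).toNNReal ≠ 0 := by
    rw [div_mul_eq_mul_div]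
    exact (Real.toNNReal_pos.2 (by positivity)).ne'
  have := nullSingletonClass_gaussianReal (μ := 0) hne
  rw [hsum]
  refine tendsto_real_bootLin_le ?_ ?_ hreg.var_left hreg.var_right hreg.max_left hreg.max_right
    (hsum ▸ measure_singleton t)
  · have := hweight.mul ((hcorr.const_sub 1).pow 2)
    simp only [sub_zero, one_pow, mul_one] at this
    exact this.congr fun k => by ring
  · have := hweight.mul ((hcorr.const_add 1).pow 2)
    simp only [add_zero, one_pow, mul_one] at this
    exact this.congr fun k => by ring

theorem tendsto_real_mul_twoStageEst_sub_le (hreg : StageTwoRegular y' y'' h θ β V) (hβ : 0 < β)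
    (hR : Tendsto (fun k => r k ^ 2 / m k) atTop (𝓝 R)) (hRV : 0 < R * V)
    (hrh : Tendsto (fun k => r k * h k) atTop atTop) (d : ℕ → ℝ) (t : ℝ) :
    Tendsto (fun k => (bootstrapMeasure (y' k) (y'' k)).real
        {q | r k * (twoStageEst θ (d k) (h k) q.1 q.2
          - twoStageEst θ (d k) (h k) (y' k) (y'' k)) ≤ t}) atTop
      (𝓝 ((gaussianReal 0 (R / (2 * β ^ 2) * V).toNNReal).real (Set.Iic t))) := by
  have hlin := hreg.tendsto_real_linearized_le hβ hR hRV hrh t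
  have hbad := hreg.tendsto_real_lsSlope_nonpos hβ hR hrh
  rw [tendsto_iff_norm_sub_tendsto_zero] at hlin ⊢
  have hbound := hbad.add hlin
  rw [add_zero] at hbound
  refine squeeze_zero' (.of_forall fun _ => norm_nonneg _) ?_ hbound
  filter_upwards [hreg.slope.eventually_const_lt hβ, hrh.eventually_gt_atTop 0] with k hk hrhk
  obtain ⟨hr0, hh0⟩ := mul_ne_zero_iff.1 hrhk.ne'
  refine (norm_sub_le_norm_sub_add_norm_sub _ _ _).trans (add_le_add ?_ le_rfl)
  rw [Real.norm_eq_abs, abs_sub_le_iff, tsub_le_iff_right, tsub_le_iff_right]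
  constructor <;> refine (measureReal_mono fun q hq => ?_).trans (measureReal_union_le _ _)
  · rcases le_or_gt (lsSlope (h k) q.1 q.2) 0 with hle | hgt
    · exact Or.inl hle
    · exact Or.inr ((mul_twoStageEst_sub_le_iff hr0 hh0 hk hgt).1 hq)
  · rcases le_or_gt (lsSlope (h k) q.1 q.2) 0 with hle | hgt
    · exact Or.inl hle
    · exact Or.inr ((mul_twoStageEst_sub_le_iff hr0 hh0 hk hgt).2 hq)

theorem tendsto_iSup_bootstrapCDF_sub (hreg : StageTwoRegular y' y'' h θ β V) (hβ : 0 < β)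
    {n : ℕ → ℕ} (hR : Tendsto (fun k => (n k : ℝ) / m k) atTop (𝓝 R)) (hRV : 0 < R * V)
    (hnh : Tendsto (fun k => √(n k) * h k) atTop atTop) (d : ℕ → ℝ) :
    Tendsto (fun k => ⨆ t, |bootstrapCDF (n k) θ (d k) (h k) (y' k) (y'' k) t
      - (gaussianReal 0 (R / (2 * β ^ 2) * V).toNNReal).real (Set.Iic t)|) atTop (𝓝 0) := by
  have hne : (R / (2 * β ^ 2) * V).toNNReal ≠ 0 := by
    rw [div_mul_eq_mul_div]
    exact (Real.toNNReal_pos.2 (by positivity)).ne'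
  have := nullSingletonClass_gaussianReal (μ := 0) hne
  have hR' : Tendsto (fun k => √(n k) ^ 2 / m k) atTop (𝓝 R) := by
    simpa only [Real.sq_sqrt (Nat.cast_nonneg _)] using hR
  simp only [← cdf_eq_real]
  refine tendsto_iSup_abs_sub_of_monotone
    (fun k s t hst => measureReal_mono fun q hq => le_trans hq hst)
    (fun k t => ⟨measureReal_nonneg, measureReal_le_one⟩) (monotone_cdf _) (continuous_cdf _)
    (tendsto_cdf_atBot _) (tendsto_cdf_atTop _) fun t => ?_
  rw [cdf_eq_real]
  exact hreg.tendsto_real_mul_twoStageEst_sub_le hβ hR' hRV hnh d t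

end StageTwoRegular

/-! ### A Hájek–Rényi inequality -/

theorem mul_le_sum_range_mul_sub {c u : ℕ → ℝ} (hc : Antitone c) (hu : ∀ k, 0 ≤ u k)
    (hu0 : u 0 = 0) (k : ℕ) :
    c k * u k ≤ ∑ j ∈ Finset.range k, c (j + 1) * (u (j + 1) - u j) := by
  induction k with
  | zero => simp [hu0]
  | succ k ih =>
    rw [Finset.sum_range_succ]
    linarith [mul_le_mul_of_nonneg_right (hc k.le_succ) (hu k)]

section Martingale

variable {Ω : Type*} {mΩ : MeasurableSpace Ω} {μ : Measure Ω} [IsFiniteMeasure μ]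
  {𝒢 : Filtration ℕ mΩ}

-- Chow's inequality: the weighted process lies below the martingale transform with weights `c`,
-- a nonnegative submartingale to which Doob's maximal inequality applies.
theorem mul_measureReal_exists_le_mul_le {U : ℕ → Ω → ℝ} (hU : Submartingale U 𝒢 μ)
    (hU_nonneg : ∀ k ω, 0 ≤ U k ω) (hU_zero : ∀ ω, U 0 ω = 0) {c : ℕ → ℝ} (hc : Antitone c)
    (hc_nonneg : ∀ k, 0 ≤ c k) {a : ℝ} (ha : 0 ≤ a) (n : ℕ) :
    a * μ.real {ω | ∃ k ≤ n, a ≤ c k * U k ω}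
      ≤ ∑ j ∈ Finset.range n, c (j + 1) * (∫ ω, U (j + 1) ω ∂μ - ∫ ω, U j ω ∂μ) := by
  lift a to NNReal using ha
  set W : ℕ → Ω → ℝ := fun k ω => ∑ j ∈ Finset.range k, c (j + 1) * (U (j + 1) ω - U j ω)
  have hUW : ∀ k ω, c k * U k ω ≤ W k ω := fun k ω =>
    mul_le_sum_range_mul_sub hc (hU_nonneg · ω) (hU_zero ω) k
  have hW_nonneg : ∀ k ω, 0 ≤ W k ω := fun k ω =>
    (mul_nonneg (hc_nonneg k) (hU_nonneg k ω)).trans (hUW k ω)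
  have hW : Submartingale W 𝒢 μ := by
    have := hU.sum_mul_sub (ξ := fun j _ => c (j + 1)) (R := c 0)
      (fun _ => stronglyMeasurable_const) (fun j _ => hc (Nat.zero_le _)) fun _ _ => hc_nonneg _
    convert this using 2
    ext ω
    simp [W]
  have hdoob := maximal_ineq hW hW_nonneg (ε := a) n
  rw [← ENNReal.toReal_le_toReal (ENNReal.mul_ne_top (by simp) (measure_ne_top _ _)) (by simp),
    ENNReal.toReal_mul, ENNReal.toReal_ofReal (integral_nonneg (hW_nonneg n))] at hdoob
  calc a * μ.real {ω | ∃ k ≤ n, a ≤ c k * U k ω}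
      ≤ a * μ.real {ω | a ≤ (Finset.range (n + 1)).sup' Finset.nonempty_range_add_one
          fun k => W k ω} := by
        refine mul_le_mul_of_nonneg_left (measureReal_mono ?_) a.2
        rintro ω ⟨k, hkn, hk⟩
        exact (Finset.le_sup'_iff _).2 ⟨k, by grind, hk.trans (hUW k ω)⟩
    _ ≤ ∫ ω, W n ω ∂μ :=
        hdoob.trans (setIntegral_le_integral (hW.integrable n) (.of_forall (hW_nonneg n)))
    _ = _ := by
        have hint : ∀ j, Integrable (fun ω => c (j + 1) * (U (j + 1) ω - U j ω)) μ := fun j =>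
          ((hU.integrable _).sub (hU.integrable _)).const_mul _
        simp only [W, integral_finsetSum _ fun j _ => hint j, integral_const_mul,
          integral_sub (hU.integrable _) (hU.integrable _)]

theorem submartingale_sq_of_martingale {S : ℕ → Ω → ℝ} (hS : Martingale S 𝒢 μ)
    (hL2 : ∀ k, MemLp (S k) 2 μ) : Submartingale (fun k ω => S k ω ^ 2) 𝒢 μ := by
  refine submartingale_nat (fun k => (hS.stronglyAdapted k).pow 2) (fun k => (hL2 k).integrable_sq)
    fun k => ?_
  have hjensen := (even_two.convexOn_pow (𝕜 := ℝ)).map_condExp_le_univ (𝒢.le k)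
    (continuous_pow 2).lowerSemicontinuous (hS.integrable (k + 1)) (hL2 (k + 1)).integrable_sq
  filter_upwards [hjensen, hS.condExp_ae_eq k.le_succ] with ω hω heq
  rwa [Function.comp_apply, heq] at hω

end Martingale

section Independent

variable {Ω : Type*} {mΩ : MeasurableSpace Ω} {μ : Measure Ω} {X : ℕ → Ω → ℝ}

theorem martingale_sum_range_succ (hXm : ∀ j, StronglyMeasurable (X j)) (hind : iIndepFun X μ)
    (hint : ∀ j, Integrable (X j) μ) (hmean : ∀ j, μ[X j] = 0) :
    Martingale (fun k ω => ∑ j ∈ Finset.range k, X (j + 1) ω) (Filtration.natural X hXm) μ := by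
  have := hind.isProbabilityMeasure
  refine martingale_of_condExp_sub_eq_zero_nat (fun k => ?_)
    (fun k => integrable_finsetSum _ fun j _ => hint _) fun k => ?_
  · refine Finset.stronglyMeasurable_fun_sum _ fun j hj => ?_
    exact (Filtration.stronglyAdapted_natural hXm (j + 1)).mono
      ((Filtration.natural X hXm).mono (Finset.mem_range.1 hj))
  · have hdiff : (fun ω => ∑ j ∈ Finset.range (k + 1), X (j + 1) ω)
        - (fun ω => ∑ j ∈ Finset.range k, X (j + 1) ω) = X (k + 1) := by
      ext ω
      simp [Finset.sum_range_succ]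
    rw [hdiff]
    filter_upwards [hind.condExp_natural_ae_eq_of_lt hXm k.lt_succ_self] with ω hω
    rw [hω, hmean, Pi.zero_apply]

theorem integral_sum_range_sq (hind : iIndepFun X μ) (hL2 : ∀ j, MemLp (X j) 2 μ)
    (hmean : ∀ j, μ[X j] = 0) (k : ℕ) :
    ∫ ω, (∑ j ∈ Finset.range k, X (j + 1) ω) ^ 2 ∂μ
      = ∑ j ∈ Finset.range k, Var[X (j + 1); μ] := by
  have := hind.isProbabilityMeasure
  rw [← IndepFun.variance_sum (fun j _ => hL2 _)
    fun i _ j _ hij => hind.indepFun (Nat.succ_injective.ne hij),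
    variance_of_integral_eq_zero (memLp_finsetSum' _ fun j _ => hL2 _).aemeasurable]
  · simp only [Finset.sum_apply]
  · simp only [Finset.sum_apply]
    rw [integral_finsetSum _ fun j _ => (hL2 _).integrable one_le_two]
    simp [hmean]

theorem sum_range_inv_max_sq_le {N : ℕ} (hN : N ≠ 0) (M : ℕ) :
    ∑ j ∈ Finset.range M, ((max N (j + 1) : ℕ) ^ 2 : ℝ)⁻¹ ≤ 2 / N := by
  have hdisj : Disjoint (Finset.range N) (Finset.Ico N (N + M)) :=
    Finset.disjoint_left.2 fun j hj hj' => by grind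
  have hhead : ∑ j ∈ Finset.range N, ((max N (j + 1) : ℕ) ^ 2 : ℝ)⁻¹ = 1 / N := by
    rw [Finset.sum_congr rfl fun j hj => by rw [max_eq_left (Finset.mem_range.1 hj)]]
    simp only [Finset.sum_const, Finset.card_range, nsmul_eq_mul]
    field_simp
  have htail : ∑ j ∈ Finset.Ico N (N + M), ((max N (j + 1) : ℕ) ^ 2 : ℝ)⁻¹ ≤ 1 / N := by
    calc _ = ∑ j ∈ Finset.Ioc N (N + M), ((j : ℝ) ^ 2)⁻¹ := by
          rw [← Finset.Ico_add_one_add_one_eq_Ioc, ← Finset.sum_Ico_add']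
          refine Finset.sum_congr rfl fun j hj => ?_
          rw [max_eq_right ((Finset.mem_Ico.1 hj).1.trans (Nat.le_add_right j 1))]
      _ ≤ (N : ℝ)⁻¹ - ((N + M : ℕ) : ℝ)⁻¹ := sum_Ioc_inv_sq_le_sub hN (Nat.le_add_right _ _)
      _ ≤ 1 / N := by
          rw [one_div]
          exact sub_le_self _ (by positivity)
  calc _ ≤ ∑ j ∈ Finset.range N ∪ Finset.Ico N (N + M), ((max N (j + 1) : ℕ) ^ 2 : ℝ)⁻¹ :=
        Finset.sum_le_sum_of_subset_of_nonneg (fun j hj => by grind) fun _ _ _ => by positivity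
    _ ≤ 2 / N := by
        rw [Finset.sum_union hdisj, hhead]
        linarith [add_div (1 : ℝ) 1 N]

theorem measureReal_exists_mul_le_abs_sum_le_of_iIndepFun (hXm : ∀ j, StronglyMeasurable (X j))
    (hind : iIndepFun X μ) (hL2 : ∀ j, MemLp (X j) 2 μ) (hmean : ∀ j, μ[X j] = 0) {v : ℝ}
    (hvar : ∀ j, Var[X j; μ] ≤ v) {N : ℕ} (hN : N ≠ 0) {r : ℝ} (hr : 0 < r) (M : ℕ) :
    μ.real {ω | ∃ k, N ≤ k ∧ k ≤ M ∧ r * k ≤ |∑ j ∈ Finset.range k, X (j + 1) ω|}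
      ≤ 2 * v / (N * r ^ 2) := by
  have := hind.isProbabilityMeasure
  have hS := martingale_sum_range_succ hXm hind (fun j => (hL2 j).integrable one_le_two) hmean
  have hchow := mul_measureReal_exists_le_mul_le
    (submartingale_sq_of_martingale hS fun k => memLp_finsetSum _ fun j _ => hL2 _)
    (fun _ _ => sq_nonneg _) (by simp) (c := fun k => ((max N k : ℕ) ^ 2 : ℝ)⁻¹)
    (fun k l hkl => by dsimp only; gcongr) (fun k => by positivity) (sq_nonneg r) M
  simp only [integral_sum_range_sq hind hL2 hmean] at hchow
  simp only [Finset.sum_range_succ_sub_sum] at hchow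
  have hsub : {ω | ∃ k, N ≤ k ∧ k ≤ M ∧ r * k ≤ |∑ j ∈ Finset.range k, X (j + 1) ω|}
      ⊆ {ω | ∃ k ≤ M, r ^ 2 ≤ ((max N k : ℕ) ^ 2 : ℝ)⁻¹
        * (∑ j ∈ Finset.range k, X (j + 1) ω) ^ 2} := by
    rintro ω ⟨k, hNk, hkM, hk⟩
    refine ⟨k, hkM, ?_⟩
    have hk0 : (0 : ℝ) < k := by exact_mod_cast (Nat.pos_of_ne_zero hN).trans_le hNk
    rw [max_eq_right hNk, inv_mul_eq_div, le_div_iff₀ (by positivity), ← mul_pow,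
      ← sq_abs (∑ j ∈ _, _)]
    gcongr
  have hv : 0 ≤ v := (variance_nonneg (X 0) μ).trans (hvar 0)
  have hweights : ∑ j ∈ Finset.range M, ((max N (j + 1) : ℕ) ^ 2 : ℝ)⁻¹ * Var[X (j + 1); μ]
      ≤ 2 / N * v := by
    grw [Finset.sum_le_sum fun j _ => mul_le_mul_of_nonneg_left (hvar (j + 1)) (by positivity),
      ← Finset.sum_mul, sum_range_inv_max_sq_le hN M]
  rw [← div_div, ← div_mul_eq_mul_div, le_div_iff₀ (by positivity), mul_comm]
  exact (mul_le_mul_of_nonneg_left (measureReal_mono hsub) (sq_nonneg r)).trans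
    (hchow.trans hweights)

end Independent

/-! ### Rows of independent, identically distributed errors -/

theorem tendsto_sq_mul_measureReal_le_abs {ρ : Measure ℝ} [IsFiniteMeasure ρ]
    (hL2 : MemLp id 2 ρ) :
    Tendsto (fun t => t ^ 2 * ρ.real {z | t ≤ |z|}) atTop (𝓝 0) := by
  have hmeas : ∀ t : ℝ, MeasurableSet {z : ℝ | t ≤ |z|} := fun t =>
    measurableSet_le measurable_const (by fun_prop)
  have hint : Integrable (fun z => z ^ 2) ρ := hL2.integrable_sq
  have htail := tendsto_setIntegral_of_antitone (μ := ρ) hmeas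
    (fun s t hst z (hz : t ≤ |z|) => hst.trans hz) ⟨0, hint.integrableOn⟩
  have hempty : ⋂ t : ℝ, {z : ℝ | t ≤ |z|} = ∅ :=
    Set.eq_empty_of_forall_notMem fun z hz =>
      absurd (Set.mem_iInter.1 hz (|z| + 1)) (by simp)
  rw [hempty, setIntegral_empty] at htail
  refine squeeze_zero' (.of_forall fun t => by positivity) ?_ htail
  filter_upwards [eventually_ge_atTop 0] with t ht
  refine setIntegral_ge_of_const_le_real (hmeas t) (measure_ne_top _ _) (fun z hz => ?_)
    hint.integrableOn
  rw [← sq_abs z]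
  gcongr
  exact hz

section Row

variable {Ω : Type*} {mΩ : MeasurableSpace Ω} {μ : Measure Ω} {ρ : Measure ℝ}
  [IsProbabilityMeasure ρ] {m : ℕ} {X : ℕ → Ω → ℝ}

theorem identDistrib_infinitePi_of_iIndepFun (hlaw : ∀ i < m, HasLaw (X i) ρ μ)
    (hind : iIndepFun (fun i : Fin m => X i) μ) :
    IdentDistrib (fun ω (i : Fin m) => X i ω) (fun (z : ℕ → ℝ) (i : Fin m) => z (i + 1)) μ
      (Measure.infinitePi fun _ => ρ) := by
  have hshift : Function.Injective fun i : Fin m => (i + 1 : ℕ) := fun i j hij => by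
    simpa [Fin.ext_iff] using hij
  have hX : AEMeasurable (fun ω (i : Fin m) => X i ω) μ :=
    aemeasurable_pi_lambda _ fun i => (hlaw i i.2).aemeasurable
  refine ⟨hX, (measurable_pi_lambda _ fun i => measurable_pi_apply _).aemeasurable, ?_⟩
  rw [(hind.hasLaw_infinitePi (fun i : Fin m => hlaw i i.2) hX).map_eq,
    Measure.map_infinitePi_infinitePi_of_inj hshift]

theorem measureReal_exists_mul_le_abs_sum_le (hlaw : ∀ i < m, HasLaw (X i) ρ μ)
    (hind : iIndepFun (fun i : Fin m => X i) μ) (hL2 : MemLp id 2 ρ) (hmean : ∫ z, z ∂ρ = 0)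
    {N : ℕ} (hN : N ≠ 0) {r : ℝ} (hr : 0 < r) :
    μ.real {ω | ∃ k, N ≤ k ∧ k ≤ m ∧ r * k ≤ |∑ j ∈ Finset.range k, X j ω|}
      ≤ 2 * Var[id; ρ] / (N * r ^ 2) := by
  have heval := fun j : ℕ => measurePreserving_eval_infinitePi (fun _ => ρ) j
  have hprod := measureReal_exists_mul_le_abs_sum_le_of_iIndepFun
    (X := fun j (z : ℕ → ℝ) => z j) (fun j => (measurable_pi_apply j).stronglyMeasurable)
    (iIndepFun_infinitePi (X := fun _ => id) fun _ => measurable_id)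
    (fun j => hL2.comp_measurePreserving (heval j))
    (fun j => ((heval j).hasLaw.integral_eq).trans hmean)
    (fun j => ((heval j).hasLaw.variance_eq).le) hN hr m
  have hrange : ∀ {k}, k ≤ m → ∀ y : ℕ → ℝ,
      ∑ j ∈ Finset.range k, y j = ∑ j : Fin m with j.1 < k, y j := fun {k} hk y => by
    rw [Finset.sum_filter, ← Finset.sum_range fun j => if j < k then y j else 0,
      ← Finset.sum_filter]
    congr 1
    grind
  set S : Set (Fin m → ℝ) :=
    ⋃ k ∈ Finset.Icc N m, {y | r * k ≤ |∑ j : Fin m with j.1 < k, y j|}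
  have hS : MeasurableSet S := Finset.measurableSet_biUnion _ fun k _ =>
    measurableSet_le measurable_const (by fun_prop)
  have hmem : ∀ y : ℕ → ℝ, (∃ k, N ≤ k ∧ k ≤ m ∧ r * k ≤ |∑ j ∈ Finset.range k, y j|) ↔
      (fun j : Fin m => y j) ∈ S := fun y => by
    simp only [S, Set.mem_iUnion, Finset.mem_Icc, Set.mem_ofPred_eq, exists_prop, and_assoc]
    refine exists_congr fun k => and_congr_right fun _ => and_congr_right fun hk => ?_
    rw [hrange hk]
  have htransfer := (identDistrib_infinitePi_of_iIndepFun hlaw hind).measure_mem_eq hS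
  simp only [hmem] at hprod ⊢
  rwa [measureReal_def, show μ {ω | (fun j : Fin m => X j ω) ∈ S} = _ from htransfer]

end Row

section Array

variable {Ω : Type*} {mΩ : MeasurableSpace Ω} {μ : Measure Ω} {ρ : Measure ℝ}
  [IsProbabilityMeasure ρ] {m : ℕ → ℕ} {X : ℕ → ℕ → Ω → ℝ}

theorem tendstoInMeasure_sampleMean_comp (hlaw : ∀ n, ∀ i < m n, HasLaw (X n i) ρ μ)
    (hind : ∀ n, iIndepFun (fun i : Fin (m n) => X n i) μ) (hm : Tendsto m atTop atTop)
    {φ : ℝ → ℝ} (hφm : Measurable φ) (hφ : Integrable φ ρ) :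
    TendstoInMeasure μ (fun n ω => sampleMean fun i : Fin (m n) => φ (X n i ω)) atTop
      fun _ => ∫ z, φ z ∂ρ := by
  have heval := fun j : ℕ => measurePreserving_eval_infinitePi (fun _ => ρ) j
  have hiid : iIndepFun (fun i (z : ℕ → ℝ) => φ (z (i + 1)))
      (Measure.infinitePi fun _ => ρ) :=
    (iIndepFun_infinitePi (X := fun _ => φ) fun _ => hφm).precomp (add_left_injective 1)
  have hslln := strong_law_ae_real (fun i (z : ℕ → ℝ) => φ (z (i + 1)))
    ((heval 1).integrable_comp_of_integrable hφ) (fun i j hij => hiid.indepFun hij)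
    fun i => ((heval (i + 1)).hasLaw.identDistrib (heval 1).hasLaw).comp hφm
  rw [show ∫ z : ℕ → ℝ, φ (z (0 + 1)) ∂(Measure.infinitePi fun _ => ρ) = ∫ z, φ z ∂ρ from
    (heval 1).hasLaw.integral_comp hφ.aestronglyMeasurable] at hslln
  have hwlln := (tendstoInMeasure_of_tendsto_ae (fun n => Measurable.aestronglyMeasurable
    (by fun_prop)) hslln).comp hm
  rw [tendstoInMeasure_iff_dist] at hwlln ⊢
  intro η hη
  refine (hwlln η hη).congr fun n => ?_
  have hS : MeasurableSet {y : Fin (m n) → ℝ |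
      η ≤ dist (sampleMean fun i => φ (y i)) (∫ z, φ z ∂ρ)} :=
    measurableSet_le measurable_const (by unfold sampleMean; fun_prop)
  have htransfer := (identDistrib_infinitePi_of_iIndepFun (hlaw n) (hind n)).measure_mem_eq hS
  have hsum : ∀ z : ℕ → ℝ, (∑ i ∈ Finset.range (m n), φ (z (i + 1))) / m n
      = sampleMean fun i : Fin (m n) => φ (z (i + 1)) := fun z => by
    rw [sampleMean, Finset.sum_range, div_eq_inv_mul]
  simp only [Function.comp_apply, hsum]
  exact htransfer.symm

theorem tendstoInMeasure_sampleMean_div (hlaw : ∀ n, ∀ i < m n, HasLaw (X n i) ρ μ)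
    (hind : ∀ n, iIndepFun (fun i : Fin (m n) => X n i) μ)
    (hL2 : MemLp id 2 ρ) (hmean : ∫ z, z ∂ρ = 0) {h : ℕ → ℝ} (h0 : ∀ᶠ n in atTop, 0 < h n)
    (hmh : Tendsto (fun n => m n * h n ^ 2) atTop atTop) :
    TendstoInMeasure μ (fun n ω => (sampleMean fun i : Fin (m n) => X n i ω) / h n) atTop
      fun _ => 0 := by
  have : IsProbabilityMeasure μ := (hind 0).isProbabilityMeasure
  rw [tendstoInMeasure_iff_measureReal_norm]
  intro η hη
  have hbound : Tendsto (fun n => 2 * Var[id; ρ] / (m n * (η * h n) ^ 2)) atTop (𝓝 0) := by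
    have := hmh.const_mul_atTop (sq_pos_of_pos hη)
    refine (tendsto_const_nhds (x := 2 * Var[id; ρ])).div_atTop (this.congr fun n => ?_)
    ring
  refine squeeze_zero' (.of_forall fun n => measureReal_nonneg) ?_ hbound
  filter_upwards [hmh.eventually_gt_atTop 0, h0] with n hpos hn
  have hm : m n ≠ 0 := fun hm => by simp [hm] at hpos
  refine (measureReal_mono ?_).trans (measureReal_exists_mul_le_abs_sum_le (hlaw n) (hind n)
    hL2 hmean hm (mul_pos hη hn))
  intro ω hω
  refine ⟨m n, le_rfl, le_rfl, ?_⟩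
  rw [Set.mem_ofPred_eq, sub_zero, Real.norm_eq_abs, abs_div, abs_of_pos hn, le_div_iff₀ hn,
    sampleMean, abs_mul, abs_inv, Nat.abs_cast, inv_mul_eq_div,
    le_div_iff₀ (by positivity), ← Finset.sum_range fun i => X n i ω] at hω
  exact hω

theorem tendstoInMeasure_norm_div_sqrt [IsFiniteMeasure μ]
    (hlaw : ∀ n, ∀ i < m n, HasLaw (X n i) ρ μ)
    (hm : Tendsto m atTop atTop) (hL2 : MemLp id 2 ρ) :
    TendstoInMeasure μ (fun n ω => ‖fun i : Fin (m n) => X n i ω‖ / √(m n)) atTop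
      fun _ => 0 := by
  rw [tendstoInMeasure_iff_measureReal_norm]
  intro η hη
  have hroot : Tendsto (fun n => η * √(m n)) atTop atTop :=
    (Real.tendsto_sqrt_atTop.comp (tendsto_natCast_atTop_atTop.comp hm)).const_mul_atTop hη
  have hbound := ((tendsto_sq_mul_measureReal_le_abs hL2).comp hroot).const_mul (η ^ 2)⁻¹
  rw [mul_zero] at hbound
  refine squeeze_zero' (.of_forall fun n => measureReal_nonneg) ?_ hbound
  filter_upwards [hm.eventually_gt_atTop 0] with n hn
  have hroot_pos : 0 < √(m n) := Real.sqrt_pos.2 (by exact_mod_cast hn)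
  have hsub : {ω | η ≤ ‖‖fun i : Fin (m n) => X n i ω‖ / √(m n) - 0‖}
      ⊆ ⋃ i : Fin (m n), {ω | η * √(m n) ≤ |X n i ω|} := fun ω hω => by
    by_contra! hlt
    simp only [Set.mem_iUnion, Set.mem_ofPred_eq, not_exists, not_le] at hlt
    have := (pi_norm_lt_iff (x := fun i : Fin (m n) => X n i ω) (mul_pos hη hroot_pos)).2 hlt
    rw [Set.mem_ofPred_eq, sub_zero, norm_div, norm_norm, Real.norm_of_nonneg hroot_pos.le,
      le_div_iff₀ hroot_pos] at hω
    exact hω.not_gt this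
  have hmeas : MeasurableSet {z : ℝ | η * √(m n) ≤ |z|} :=
    measurableSet_le measurable_const (by fun_prop)
  calc _ ≤ ∑ i : Fin (m n), μ.real {ω | η * √(m n) ≤ |X n i ω|} :=
        (measureReal_mono hsub).trans (measureReal_iUnion_fintype_le _)
    _ = ∑ _ : Fin (m n), ρ.real {z | η * √(m n) ≤ |z|} :=
        Finset.sum_congr rfl fun i _ => (hlaw n i i.2).measureReal_eq hmeas
    _ = (η ^ 2)⁻¹ * ((η * √(m n)) ^ 2 * ρ.real {z | η * √(m n) ≤ |z|}) := by
        rw [Finset.sum_const, Finset.card_univ, Fintype.card_fin, nsmul_eq_mul, mul_pow,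
          Real.sq_sqrt (Nat.cast_nonneg _)]
        field_simp

end Array

/-! ### Blocks of an isotonic regression -/

theorem exists_le_forall_lt_iff {m : ℕ} {p : ℕ → Prop}
    (hp : ∀ i j, i ≤ j → j < m → p j → p i) : ∃ B ≤ m, ∀ i < m, p i ↔ i < B := by
  classical
  have hex : ∃ i, ¬ (i < m ∧ p i) := ⟨m, by simp⟩
  refine ⟨Nat.find hex, Nat.find_min' hex (by simp), fun i hi => ⟨fun hpi => ?_, fun hlt => ?_⟩⟩
  · exact lt_of_not_ge fun hle => Nat.find_spec hex ⟨hle.trans_lt hi, hp _ _ hle hi hpi⟩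
  · exact (not_not.1 (Nat.find_min hex hlt)).2

section Isotonic

variable {m : ℕ} {x Y : ℕ → ℝ} {u : ℝ → ℝ}

theorem IsIsotonicRegression.reflect (hu : IsIsotonicRegression m x Y u) :
    IsIsotonicRegression m (fun i => 1 - x (m - 1 - i)) (fun i => -Y (m - 1 - i))
      fun t => -u (1 - t) := by
  have hreflect : ∀ {h : ℝ → ℝ}, MonotoneOn h (Set.Icc 0 1) →
      MonotoneOn (fun t => -h (1 - t)) (Set.Icc 0 1) := fun {h} hh s hs t ht hst =>
    neg_le_neg (hh (by grind) (by grind) (by linarith))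
  refine ⟨hreflect hu.1, fun h hh => ?_⟩
  have hmin := hu.2 _ (hreflect hh)
  rw [← Finset.sum_range_reflect, ← Finset.sum_range_reflect (fun i => (Y i - _) ^ 2)] at hmin
  refine (Finset.sum_congr rfl fun i _ => ?_).trans_le (hmin.trans_eq
    (Finset.sum_congr rfl fun i _ => ?_))
  · simp only [sub_sub_cancel]
    ring
  · ring

-- The fit stays nondecreasing when, at and beyond `x i₀`, its values up to `θ` are raised by `s`.
theorem IsIsotonicRegression.sum_sub_nonpos (hx : StrictMonoOn x (Set.Iio m))
    (hu : IsIsotonicRegression m x Y u) (i₀ : ℕ) (θ : ℝ) :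
    ∑ i ∈ Finset.range m with i₀ ≤ i ∧ u (x i) ≤ θ, (Y i - u (x i)) ≤ 0 := by
  rcases le_or_gt m i₀ with hi₀ | hi₀
  · exact (Finset.sum_eq_zero fun i hi => by grind).le
  set E := (Finset.range m).filter fun i => i₀ ≤ i ∧ u (x i) ≤ θ
  have hgap : ∀ᶠ s in 𝓝[>] (0 : ℝ), ∀ i ∈ Finset.range m, θ < u (x i) → θ + s ≤ u (x i) := by
    refine (Finset.eventually_all _).2 fun i _ => ?_
    by_cases hi : θ < u (x i)
    · filter_upwards [nhdsWithin_le_nhds (Iic_mem_nhds (sub_pos.2 hi))] with s hs _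
      linarith [Set.mem_Iic.1 hs]
    · exact .of_forall fun _ h => absurd h hi
  have hlim : Tendsto (fun s : ℝ => s * E.card / 2) (𝓝[>] 0) (𝓝 0) :=
    tendsto_nhdsWithin_of_tendsto_nhds (Continuous.tendsto' (by fun_prop) _ _ (by simp))
  refine ge_of_tendsto hlim ?_
  filter_upwards [hgap, self_mem_nhdsWithin] with s hs (hs0 : 0 < s)
  set h : ℝ → ℝ := fun t => if x i₀ ≤ t then max (u t) (min (u t) θ + s) else u t
  have hh : MonotoneOn h (Set.Icc 0 1) := fun t ht t' ht' htt => by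
    have := hu.1 ht ht' htt
    simp only [h]
    split_ifs with h₁ h₂
    · gcongr
    · exact absurd (h₁.trans htt) h₂
    · exact this.trans (le_max_left _ _)
    · exact this
  have hval : ∀ i ∈ Finset.range m, (Y i - h (x i)) ^ 2
      = (Y i - u (x i)) ^ 2 - if i ∈ E then 2 * s * (Y i - u (x i)) - s ^ 2 else 0 := by
    intro i hi
    have hle : x i₀ ≤ x i ↔ i₀ ≤ i := hx.le_iff_le hi₀ (Finset.mem_range.1 hi)
    simp only [h, E, Finset.mem_filter, hi, hle, true_and]
    by_cases h₁ : i₀ ≤ i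
    · rcases le_or_gt (u (x i)) θ with h₂ | h₂
      · rw [if_pos h₁, if_pos ⟨h₁, h₂⟩, min_eq_left h₂, max_eq_right (by linarith)]
        ring
      · rw [if_pos h₁, if_neg (by grind), min_eq_right h₂.le, max_eq_left (hs i hi h₂), sub_zero]
    · rw [if_neg h₁, if_neg (by grind), sub_zero]
  have hmin := hu.2 h hh
  rw [Finset.sum_congr rfl hval, Finset.sum_sub_distrib, Finset.sum_ite_mem,
    Finset.inter_eq_right.2 (Finset.filter_subset _ _), Finset.sum_sub_distrib, ← Finset.mul_sum,
    Finset.sum_const, nsmul_eq_mul] at hmin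
  rw [le_div_iff₀ two_pos]
  refine le_of_mul_le_mul_left ?_ hs0
  linarith

variable {f e : ℕ → ℝ}

theorem IsIsotonicRegression.exists_block_right (hx : ∀ i < m, x i ∈ Set.Icc (0 : ℝ) 1)
    (hx_mono : StrictMonoOn x (Set.Iio m)) (hu : IsIsotonicRegression m x (fun i => f i + e i) u)
    {θ Δ : ℝ} (hΔ : 0 ≤ Δ) {i₀ i₁ i₂ N : ℕ} (h₀₁ : i₀ ≤ i₁) (hi₂ : i₂ ≤ m) (hN : 0 < N)
    (hN₁ : i₁ ≤ i₀ + 2 * N) (hN₂ : i₁ + N ≤ i₂)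
    (hf : ∀ i < m, i₀ ≤ i → θ ≤ f i) (hf' : ∀ i < m, i₁ ≤ i → θ + Δ ≤ f i)
    (huθ : ∀ i < i₂, u (x i) ≤ θ) :
    ∃ k, N ≤ k ∧ k ≤ m - i₀ ∧ Δ / 3 * k ≤ |∑ j ∈ Finset.range k, e (i₀ + j)| := by
  obtain ⟨B, hBm, hB⟩ := exists_le_forall_lt_iff (m := m) (p := fun i => u (x i) ≤ θ)
    fun i j hij hj h => (hu.1 (hx i (hij.trans_lt hj)) (hx j hj)
      (hx_mono.monotoneOn (hij.trans_lt hj) hj hij)).trans h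
  have hBi₂ : i₂ ≤ B := by
    by_contra! hlt
    exact lt_irrefl B ((hB B (by omega)).1 (huθ B hlt))
  have hE : (Finset.range m).filter (fun i => i₀ ≤ i ∧ u (x i) ≤ θ) = Finset.Ico i₀ B := by
    ext i
    grind
  have hsum := hu.sum_sub_nonpos hx_mono i₀ θ
  rw [hE] at hsum
  have herr : ∑ i ∈ Finset.Ico i₀ B, (f i - θ) + ∑ i ∈ Finset.Ico i₀ B, e i ≤ 0 := by
    rw [← Finset.sum_add_distrib]
    refine (Finset.sum_le_sum fun i hi => ?_).trans hsum
    have := (hB i (by grind)).2 (by grind)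
    linarith
  rw [← Finset.sum_Ico_consecutive _ h₀₁ (by omega : i₁ ≤ B)] at herr
  have hsignal₀ : 0 ≤ ∑ i ∈ Finset.Ico i₀ i₁, (f i - θ) :=
    Finset.sum_nonneg fun i hi => sub_nonneg.2 (hf i (by grind) (by grind))
  have hsignal₁ : (B - i₁ : ℕ) * Δ ≤ ∑ i ∈ Finset.Ico i₁ B, (f i - θ) := by
    rw [← nsmul_eq_mul, ← Nat.card_Ico]
    exact Finset.card_nsmul_le_sum _ _ _ fun i hi =>
      le_sub_iff_add_le'.2 (hf' i (by grind) (by grind))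
  have hlength : ((B - i₀ : ℕ) : ℝ) ≤ 3 * (B - i₁ : ℕ) := by
    exact_mod_cast (by omega : B - i₀ ≤ 3 * (B - i₁))
  refine ⟨B - i₀, by omega, by omega, ?_⟩
  rw [← Finset.sum_Ico_eq_sum_range]
  have := neg_le_abs (∑ i ∈ Finset.Ico i₀ B, e i)
  nlinarith

theorem IsIsotonicRegression.exists_block_left (hx : ∀ i < m, x i ∈ Set.Icc (0 : ℝ) 1)
    (hx_mono : StrictMonoOn x (Set.Iio m)) (hu : IsIsotonicRegression m x (fun i => f i + e i) u)
    {θ Δ : ℝ} (hΔ : 0 ≤ Δ) {i₀ i₁ i₂ N : ℕ} (h₁₀ : i₁ ≤ i₀) (hi₀ : i₀ ≤ m) (hN : 0 < N)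
    (hN₁ : i₀ ≤ i₁ + 2 * N) (hN₂ : i₂ + N ≤ i₁)
    (hf : ∀ i < i₀, f i ≤ θ) (hf' : ∀ i < i₁, f i ≤ θ - Δ)
    (huθ : ∀ i < m, i₂ ≤ i → θ ≤ u (x i)) :
    ∃ k, N ≤ k ∧ k ≤ i₀ ∧ Δ / 3 * k ≤ |∑ j ∈ Finset.range k, e (i₀ - 1 - j)| := by
  have hu' : IsIsotonicRegression m (fun i => 1 - x (m - 1 - i))
      (fun i => -f (m - 1 - i) + -e (m - 1 - i)) fun t => -u (1 - t) := by
    simpa only [neg_add] using hu.reflect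
  have hx' : ∀ i < m, 1 - x (m - 1 - i) ∈ Set.Icc (0 : ℝ) 1 := fun i hi =>
    Set.Icc.one_sub_mem (hx _ (by omega))
  have hx_mono' : StrictMonoOn (fun i => 1 - x (m - 1 - i)) (Set.Iio m) := fun i hi j hj hij => by
    simp only [Set.mem_Iio] at hi hj
    exact sub_lt_sub_left (hx_mono (by grind) (by grind) (by omega)) 1
  obtain ⟨k, hNk, hkm, hk⟩ := hu'.exists_block_right (θ := -θ) (i₀ := m - i₀) (i₁ := m - i₁)
    (i₂ := m - i₂) hx' hx_mono' hΔ (by omega) (by omega) hN (by omega) (by omega)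
    (fun i hi hi₀ => neg_le_neg (hf _ (by omega)))
    (fun i hi hi₁ => by linarith [hf' (m - 1 - i) (by omega)])
    (fun i hi => by simpa only [sub_sub_cancel] using neg_le_neg (huθ _ (by omega) (by omega)))
  refine ⟨k, hNk, by omega, hk.trans_eq ?_⟩
  rw [Finset.sum_neg_distrib, abs_neg]
  congr 1
  refine Finset.sum_congr rfl fun j _ => congrArg e ?_
  grind

/-- The number of design points among the first `m` that are at most `t`, that is, `m` times the
empirical distribution function; for an increasing design the points with index below it. -/
noncomputable def designCount (m : ℕ) (x : ℕ → ℝ) (t : ℝ) : ℕ :=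
  ((Finset.range m).filter fun i => x i ≤ t).card

theorem designCount_le (m : ℕ) (x : ℕ → ℝ) (t : ℝ) : designCount m x t ≤ m :=
  (Finset.card_filter_le _ _).trans_eq (Finset.card_range m)

theorem designCount_mono (m : ℕ) (x : ℕ → ℝ) : Monotone (designCount m x) := fun _ _ hst =>
  Finset.card_le_card (Finset.monotone_filter_right _ fun _ _ h => h.trans hst)

theorem le_iff_lt_designCount (hx : StrictMonoOn x (Set.Iio m)) {t : ℝ} {i : ℕ} (hi : i < m) :
    x i ≤ t ↔ i < designCount m x t := by
  obtain ⟨B, hBm, hB⟩ := exists_le_forall_lt_iff (m := m) (p := fun i => x i ≤ t)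
    fun i j hij hj h => (hx.monotoneOn (hij.trans_lt hj) hj hij).trans h
  have hrange : (Finset.range m).filter (fun i => x i ≤ t) = Finset.range B := by
    ext j
    grind
  rw [designCount, hrange, Finset.card_range, hB i hi]

theorem lt_or_le_of_lt_abs_inverseAt_sub (hu : MonotoneOn u (Set.Icc 0 1)) {θ d r : ℝ}
    (h₀ : 0 ≤ d - r) (h₁ : d + r ≤ 1) (hr : 0 ≤ r) (hlt : r < |inverseAt u θ - d|) :
    u (d + r) < θ ∨ θ ≤ u (d - r) := by
  by_contra! ⟨hright, hleft⟩
  have hmem : d + r ∈ {t | t ∈ Set.Icc (0 : ℝ) 1 ∧ θ ≤ u t} := ⟨⟨by linarith, h₁⟩, hright⟩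
  have hupper : inverseAt u θ ≤ d + r := csInf_le ⟨0, fun t ht => ht.1.1⟩ hmem
  have hlower : d - r ≤ inverseAt u θ := le_csInf ⟨_, hmem⟩ fun t ht => not_lt.1 fun htr =>
    (hleft.trans_le ht.2).not_ge (hu ht.1 ⟨h₀, by linarith⟩ htr.le)
  exact hlt.not_ge (abs_le.2 ⟨by linarith, by linarith⟩)

/-- The errors at the `k` design points following `d`, or preceding it, average at least `a` in
absolute value, for some `k ≥ N`. -/
def HasLargeBlock (m : ℕ) (x e : ℕ → ℝ) (d a : ℝ) (N : ℕ) : Prop :=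
  (∃ k, N ≤ k ∧ k ≤ m - designCount m x d ∧
      a * k ≤ |∑ j ∈ Finset.range k, e (designCount m x d + j)|) ∨
    ∃ k, N ≤ k ∧ k ≤ designCount m x d ∧
      a * k ≤ |∑ j ∈ Finset.range k, e (designCount m x d - 1 - j)|

theorem IsIsotonicRegression.hasLargeBlock {φ : ℝ → ℝ} (hφ : MonotoneOn φ (Set.Icc 0 1))
    (hx : ∀ i < m, x i ∈ Set.Icc (0 : ℝ) 1) (hx_mono : StrictMonoOn x (Set.Iio m))
    (hu : IsIsotonicRegression m x (fun i => φ (x i) + e i) u) {d r Δ : ℝ} (hr : 0 ≤ r)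
    (h₀ : 0 ≤ d - r) (h₁ : d + r ≤ 1) (hΔ : 0 ≤ Δ)
    (hφ_right : φ d + Δ ≤ φ (d + r / 2)) (hφ_left : φ (d - r / 2) ≤ φ d - Δ) {N : ℕ} (hN : 0 < N)
    (hN₁ : designCount m x (d + r / 2) ≤ designCount m x d + 2 * N)
    (hN₂ : designCount m x (d + r / 2) + N ≤ designCount m x (d + r))
    (hN₃ : designCount m x d ≤ designCount m x (d - r / 2) + 2 * N)
    (hN₄ : designCount m x (d - r) + N ≤ designCount m x (d - r / 2))
    (hlt : r < |inverseAt u (φ d) - d|) : HasLargeBlock m x e d (Δ / 3) N := by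
  have hcount : ∀ t, ∀ i < m, x i ≤ t ↔ i < designCount m x t := fun t i hi =>
    le_iff_lt_designCount hx_mono hi
  have hcount' : ∀ t, ∀ i < m, designCount m x t ≤ i → t ≤ x i := fun t i hi hti =>
    (lt_of_not_ge fun h => hti.not_gt ((hcount t i hi).1 h)).le
  have hle : ∀ t i, i < designCount m x t → i < m ∧ x i ≤ t := fun t i hi =>
    have him := hi.trans_le (designCount_le m x t)
    ⟨him, (hcount t i him).2 hi⟩
  have hd : ∀ c, -r ≤ c → c ≤ r → d + c ∈ Set.Icc (0 : ℝ) 1 := fun c h h' =>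
    ⟨by linarith, by linarith⟩
  have hd' := hd 0 (by linarith) hr
  rw [add_zero] at hd'
  rcases lt_or_le_of_lt_abs_inverseAt_sub hu.1 h₀ h₁ hr hlt with hright | hleft
  · refine .inl <| hu.exists_block_right (f := φ ∘ x) hx hx_mono hΔ
      (designCount_mono m x (by linarith)) (designCount_le m x _) hN hN₁ hN₂
      (fun i hi hdi => hφ hd' (hx i hi) (hcount' _ i hi hdi))
      (fun i hi hdi => hφ_right.trans ?_) fun i hi => le_trans ?_ hright.le
    · exact hφ (hd _ (by linarith) (by linarith)) (hx i hi) (hcount' _ i hi hdi)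
    · exact hu.1 (hx i (hle _ i hi).1) (hd r (by linarith) le_rfl) (hle _ i hi).2
  · refine .inr <| hu.exists_block_left (f := φ ∘ x) hx hx_mono hΔ
      (designCount_mono m x (by linarith)) (designCount_le m x _) hN hN₃ hN₄
      (fun i hi => hφ (hx i (hle _ i hi).1) hd' (hle _ i hi).2)
      (fun i hi => le_trans ?_ hφ_left) fun i hi hdi => hleft.trans ?_
    · exact hφ (hx i (hle _ i hi).1) (hd (-(r / 2)) (by linarith) (by linarith)) (hle _ i hi).2
    · exact hu.1 (hd (-r) le_rfl (by linarith)) (hx i hi) (hcount' _ i hi hdi)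

end Isotonic

/-! ### The rate of the first-stage estimator -/

theorem tendsto_sub_div_of_hasDerivAt {ι : Type*} {l : Filter ι} {F : ℝ → ℝ} {F' d : ℝ}
    (hF : HasDerivAt F F' d) {r : ι → ℝ} (hr : Tendsto r l (𝓝 0)) (hr0 : ∀ᶠ i in l, r i ≠ 0)
    {c : ι → ℝ} {c₀ : ℝ} (hc : Tendsto c l (𝓝 c₀)) :
    Tendsto (fun i => (F (d + c i * r i) - F d) / r i) l (𝓝 (c₀ * F')) := by
  have hpoint : Tendsto (fun i => d + c i * r i) l (𝓝 d) := by
    simpa using (hc.mul hr).const_add d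
  have hincrement : (fun i => d + c i * r i - d) =O[l] r := by
    simpa using (hc.isBigO_one ℝ).mul (isBigO_refl r l)
  have hremainder :=
    (((hasDerivAt_iff_isLittleO.1 hF).comp_tendsto hpoint).trans_isBigO
      hincrement).tendsto_div_nhds_zero
  refine (zero_add (c₀ * F') ▸ hremainder.add (hc.mul_const F')).congr' ?_
  filter_upwards [hr0] with i hi
  simp only [Function.comp_apply, smul_eq_mul]
  field_simp
  ring

theorem isBigO_rpow_neg_one_third {m r : ℕ → ℝ} (hm : ∀ n, 0 ≤ m n) (hr0 : ∀ᶠ n in atTop, 0 < r n)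
    (hmr : Tendsto (fun n => m n * r n ^ 3) atTop atTop) :
    (fun n => m n ^ (-(1 / 3) : ℝ)) =O[atTop] r := by
  refine IsBigO.of_bound 1 ?_
  filter_upwards [hr0, hmr.eventually_ge_atTop 1] with n hr hn
  have hm' : 0 < m n := (hm n).lt_of_ne' fun h0 => by norm_num [h0] at hn
  rw [one_mul, Real.norm_of_nonneg (by positivity), Real.norm_of_nonneg hr.le]
  refine le_of_pow_le_pow_left₀ three_ne_zero hr.le ?_
  have hcube : (m n ^ (-(1 / 3) : ℝ)) ^ 3 = (m n)⁻¹ := by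
    rw [← Real.rpow_mul_natCast hm'.le, ← Real.rpow_neg_one]
    norm_num
  rwa [hcube, inv_le_iff_one_le_mul₀' hm']

theorem abs_empiricalCDF_sub_cdf_le (m : ℕ) (x : ℕ → ℝ) (ν : Measure ℝ) {t : ℝ}
    (ht : t ∈ Set.Icc (0 : ℝ) 1) :
    |empiricalCDF m x t - cdf ν t|
      ≤ ⨆ s : Set.Icc (0 : ℝ) 1, |empiricalCDF m x s - cdf ν s| := by
  refine le_ciSup (f := fun s : Set.Icc (0 : ℝ) 1 => |empiricalCDF m x s - cdf ν s|)
    ⟨1, ?_⟩ ⟨t, ht⟩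
  rintro _ ⟨s, rfl⟩
  have hnonneg : 0 ≤ empiricalCDF m x s := div_nonneg (Nat.cast_nonneg _) (Nat.cast_nonneg _)
  have hle_one : empiricalCDF m x s ≤ 1 :=
    div_le_one_of_le₀ (mod_cast designCount_le m x s) (Nat.cast_nonneg _)
  exact abs_sub_le_iff.2 ⟨by linarith [cdf_nonneg ν s], by linarith [cdf_le_one ν s]⟩

section Design

variable {m : ℕ → ℕ} {x : ℕ → ℕ → ℝ} {d₀ : ℝ} {r : ℕ → ℝ}

theorem DesignA1.exists_tendsto_empiricalCDF_sub_div (hA1 : DesignA1 m x d₀)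
    (hd₀ : d₀ ∈ Set.Ioo (0 : ℝ) 1) (hr : Tendsto r atTop (𝓝 0)) (hr0 : ∀ᶠ n in atTop, 0 < r n)
    (hmr : Tendsto (fun n => (m n : ℝ) * r n ^ 3) atTop atTop) :
    ∃ g : ℝ, 0 < g ∧ ∀ a b : ℝ, Tendsto (fun n =>
      (empiricalCDF (m n) (x n) (d₀ + b * r n) - empiricalCDF (m n) (x n) (d₀ + a * r n)) / r n)
        atTop (𝓝 ((b - a) * g)) := by
  obtain ⟨ν, g, _, -, -, -, hder, hg, ho⟩ := hA1
  have hsup := (ho.trans_isBigO (isBigO_rpow_neg_one_third (fun n => Nat.cast_nonneg (m n)) hr0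
    hmr)).tendsto_div_nhds_zero
  have hincrement : ∀ c : ℝ, Tendsto (fun n =>
      (empiricalCDF (m n) (x n) (d₀ + c * r n) - cdf ν d₀) / r n) atTop (𝓝 (c * g d₀)) := by
    intro c
    have hmem : ∀ᶠ n in atTop, d₀ + c * r n ∈ Set.Icc (0 : ℝ) 1 :=
      (show Tendsto (fun n => d₀ + c * r n) atTop (𝓝 d₀) by
        simpa using (hr.const_mul c).const_add d₀).eventually (Icc_mem_nhds hd₀.1 hd₀.2)
    have herror : Tendsto (fun n => (empiricalCDF (m n) (x n) (d₀ + c * r n)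
        - cdf ν (d₀ + c * r n)) / r n) atTop (𝓝 0) := by
      refine squeeze_zero_norm' ?_ hsup
      filter_upwards [hmem, hr0] with n hn hrn
      rw [norm_div, Real.norm_of_nonneg hrn.le]
      gcongr
      exact abs_empiricalCDF_sub_cdf_le _ _ _ hn
    refine (zero_add (c * g d₀) ▸ herror.add (tendsto_sub_div_of_hasDerivAt hder hr
      (hr0.mono fun _ => ne_of_gt) tendsto_const_nhds)).congr fun n => ?_
    ring
  refine ⟨g d₀, hg, fun a b => ?_⟩
  rw [sub_mul]
  refine ((hincrement b).sub (hincrement a)).congr fun n => ?_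
  ring

theorem DesignA1.exists_eventually_designCount_add_le (hA1 : DesignA1 m x d₀)
    (hd₀ : d₀ ∈ Set.Ioo (0 : ℝ) 1) (hr : Tendsto r atTop (𝓝 0)) (hr0 : ∀ᶠ n in atTop, 0 < r n)
    (hmr : Tendsto (fun n => (m n : ℝ) * r n ^ 3) atTop atTop) :
    ∃ c : ℝ, 0 < c ∧ ∀ a : ℝ, ∀ᶠ n in atTop,
      designCount (m n) (x n) (d₀ + a * r n) + ⌈c * (m n * r n)⌉₊
          ≤ designCount (m n) (x n) (d₀ + (a + 1 / 2) * r n) ∧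
        designCount (m n) (x n) (d₀ + (a + 1 / 2) * r n)
          ≤ designCount (m n) (x n) (d₀ + a * r n) + 2 * ⌈c * (m n * r n)⌉₊ := by
  obtain ⟨g, hg, hcdf⟩ := hA1.exists_tendsto_empiricalCDF_sub_div hd₀ hr hr0 hmr
  have hmr₁ : Tendsto (fun n => (m n : ℝ) * r n) atTop atTop := by
    refine tendsto_atTop_mono' _ ?_ hmr
    filter_upwards [hr0, hr.eventually_le_const one_pos] with n h0 h1
    gcongr
    exact pow_le_of_le_one h0.le h1 three_ne_zero
  have hceil : Tendsto (fun n => (⌈g / 3 * (m n * r n)⌉₊ : ℝ) / (m n * r n)) atTop (𝓝 (g / 3)) :=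
    (tendsto_nat_ceil_mul_div_atTop (by positivity)).comp hmr₁
  refine ⟨g / 3, by positivity, fun a => ?_⟩
  have hcount := hcdf a (a + 1 / 2)
  filter_upwards [hceil.eventually_lt hcount (by linarith),
    hcount.eventually_lt (hceil.const_mul 2) (by linarith), hmr₁.eventually_gt_atTop 0,
    hr0] with n hlow hhigh hmr_pos hr_pos
  have hm : (0 : ℝ) < m n := pos_of_mul_pos_left hmr_pos hr_pos.le
  have hcard : ∀ t, empiricalCDF (m n) (x n) t = designCount (m n) (x n) t / m n := fun _ => rfl
  rw [hcard, hcard, ← sub_div, div_div] at hlow hhigh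
  rw [div_lt_div_iff_of_pos_right hmr_pos, lt_sub_iff_add_lt'] at hlow
  rw [← mul_div_assoc, div_lt_div_iff_of_pos_right hmr_pos, sub_lt_iff_lt_add'] at hhigh
  exact ⟨mod_cast hlow.le, mod_cast hhigh.le⟩

variable {f : ℝ → ℝ} {f' : ℝ}

theorem DesignA1.exists_eventually_hasLargeBlock (hA1 : DesignA1 m x d₀)
    (hd₀ : d₀ ∈ Set.Ioo (0 : ℝ) 1) (hf : MonotoneOn f (Set.Icc 0 1)) (hder : HasDerivAt f f' d₀)
    (hf' : 0 < f') (hx : ∀ n, ∀ i < m n, x n i ∈ Set.Icc (0 : ℝ) 1)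
    (hx_mono : ∀ n, StrictMonoOn (x n) (Set.Iio (m n)))
    (hr : Tendsto r atTop (𝓝 0)) (hr0 : ∀ᶠ n in atTop, 0 < r n)
    (hmr : Tendsto (fun n => (m n : ℝ) * r n ^ 3) atTop atTop) :
    ∃ c : ℝ, 0 < c ∧ ∀ᶠ n in atTop, ∀ e u,
      IsIsotonicRegression (m n) (x n) (fun i => f (x n i) + e i) u →
        r n < |inverseAt u (f d₀) - d₀| →
          HasLargeBlock (m n) (x n) e d₀ (f' / 4 * r n / 3) ⌈c * (m n * r n)⌉₊ := by
  obtain ⟨c, hc, hcount⟩ := hA1.exists_eventually_designCount_add_le hd₀ hr hr0 hmr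
  have hslope := fun a : ℝ => tendsto_sub_div_of_hasDerivAt hder hr
    (hr0.mono fun _ => ne_of_gt) (tendsto_const_nhds (x := a))
  have hmem : ∀ a : ℝ, ∀ᶠ n in atTop, d₀ + a * r n ∈ Set.Icc (0 : ℝ) 1 := fun a =>
    (show Tendsto (fun n => d₀ + a * r n) atTop (𝓝 d₀) by
      simpa using (hr.const_mul a).const_add d₀).eventually (Icc_mem_nhds hd₀.1 hd₀.2)
  refine ⟨c, hc, ?_⟩
  filter_upwards [hcount 0, hcount (1 / 2), hcount (-1), hcount (-(1 / 2)),
    (hslope (1 / 2)).eventually_const_lt (u := f' / 4) (by linarith),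
    (hslope (-(1 / 2))).eventually_lt_const (u := -(f' / 4)) (by linarith),
    hmem 1, hmem (-1), hr0, hmr.eventually_gt_atTop 0]
    with n hcnt₀ hcnt_right hcnt_left hcnt₀' hright hleft hmem_right hmem_left hrn hmrn e u hu hlt
  have hm : (0 : ℝ) < m n := pos_of_mul_pos_left hmrn (by positivity)
  have harg : d₀ + 0 * r n = d₀ ∧ d₀ + (0 + 1 / 2) * r n = d₀ + r n / 2 ∧
      d₀ + 1 / 2 * r n = d₀ + r n / 2 ∧ d₀ + (1 / 2 + 1 / 2) * r n = d₀ + r n ∧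
      d₀ + -1 * r n = d₀ - r n ∧ d₀ + (-1 + 1 / 2) * r n = d₀ - r n / 2 ∧
      d₀ + -(1 / 2) * r n = d₀ - r n / 2 ∧ d₀ + (-(1 / 2) + 1 / 2) * r n = d₀ := by
    refine ⟨?_, ?_, ?_, ?_, ?_, ?_, ?_, ?_⟩ <;> ring
  simp only [harg] at hcnt₀ hcnt_right hcnt_left hcnt₀' hright hleft
  rw [lt_div_iff₀ hrn] at hright
  rw [div_lt_iff₀ hrn] at hleft
  exact hu.hasLargeBlock hf (hx n) (hx_mono n) hrn.le (by linarith [hmem_left.1])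
    (by linarith [hmem_right.2]) (by positivity) (by linarith) (by linarith)
    (Nat.ceil_pos.2 (by positivity)) hcnt₀.2 hcnt_right.1 hcnt₀'.2 hcnt_left.1 hlt

variable {Ω : Type*} {mΩ : MeasurableSpace Ω} {P : Measure Ω} {ρ : Measure ℝ}
  [IsProbabilityMeasure ρ]

theorem measureReal_hasLargeBlock_le {m : ℕ} {e : ℕ → Ω → ℝ} (hlaw : ∀ i < m, HasLaw (e i) ρ P)
    (hind : iIndepFun (fun i : Fin m => e i) P) (hL2 : MemLp id 2 ρ) (hmean : ∫ z, z ∂ρ = 0)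
    {N : ℕ} (hN : N ≠ 0) {a : ℝ} (ha : 0 < a) (x : ℕ → ℝ) (d : ℝ) :
    P.real {ω | HasLargeBlock m x (fun i => e i ω) d a N} ≤ 4 * Var[id; ρ] / (N * a ^ 2) := by
  have := hind.isProbabilityMeasure
  have hblock : ∀ (k : ℕ) (τ : ℕ → ℕ) (hτ : ∀ j < k, τ j < m),
      Set.InjOn τ (Set.Iio k) →
      P.real {ω | ∃ l, N ≤ l ∧ l ≤ k ∧ a * l ≤ |∑ j ∈ Finset.range l, e (τ j) ω|}
        ≤ 2 * Var[id; ρ] / (N * a ^ 2) := fun k τ hτ hinj =>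
    measureReal_exists_mul_le_abs_sum_le (fun j hj => hlaw _ (hτ j hj))
      (hind.precomp (g := fun j : Fin k => ⟨τ j, hτ j j.2⟩) fun i j hij =>
        Fin.ext (hinj i.2 j.2 (Fin.mk.inj_iff.1 hij))) hL2 hmean hN ha
  have hcount := designCount_le m x d
  calc P.real {ω | HasLargeBlock m x (fun i => e i ω) d a N}
      ≤ 2 * Var[id; ρ] / (N * a ^ 2) + 2 * Var[id; ρ] / (N * a ^ 2) :=
        (measureReal_union_le _ _).trans (add_le_add
          (hblock _ _ (by omega) fun i _ j _ hij => by simpa using hij)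
          (hblock _ _ (by omega) fun i hi j hj hij => by
            simp only [Set.mem_Iio] at hi hj
            omega))
    _ = 4 * Var[id; ρ] / (N * a ^ 2) := by ring

theorem tendstoInMeasure_inverseAt_sub_div (hA1 : DesignA1 m x d₀)
    (hd₀ : d₀ ∈ Set.Ioo (0 : ℝ) 1) (hf : MonotoneOn f (Set.Icc 0 1)) (hder : HasDerivAt f f' d₀)
    (hf' : 0 < f') (hx : ∀ n, ∀ i < m n, x n i ∈ Set.Icc (0 : ℝ) 1)
    (hx_mono : ∀ n, StrictMonoOn (x n) (Set.Iio (m n))) {ε : ℕ → ℕ → Ω → ℝ}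
    (hlaw : ∀ n, ∀ i < m n, HasLaw (ε n i) ρ P)
    (hind : ∀ n, iIndepFun (fun i : Fin (m n) => ε n i) P)
    (hL2 : MemLp id 2 ρ) (hmean : ∫ z, z ∂ρ = 0) {fhat : ℕ → Ω → ℝ → ℝ}
    (hfhat : ∀ n ω, IsIsotonicRegression (m n) (x n) (fun i => f (x n i) + ε n i ω) (fhat n ω))
    {h : ℕ → ℝ} (hh : Tendsto h atTop (𝓝 0)) (hh0 : ∀ᶠ n in atTop, 0 < h n)
    (hmh : Tendsto (fun n => (m n : ℝ) * h n ^ 3) atTop atTop) :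
    TendstoInMeasure P (fun n ω => (inverseAt (fhat n ω) (f d₀) - d₀) / h n) atTop
      fun _ => 0 := by
  have := (hind 0).isProbabilityMeasure
  rw [tendstoInMeasure_iff_measureReal_norm]
  intro η hη
  set r : ℕ → ℝ := fun n => η / 2 * h n
  have hr : Tendsto r atTop (𝓝 0) := mul_zero (η / 2) ▸ hh.const_mul (η / 2)
  have hr0 : ∀ᶠ n in atTop, 0 < r n := hh0.mono fun n hn => mul_pos (half_pos hη) hn
  have hmr : Tendsto (fun n => m n * r n ^ 3) atTop atTop :=
    (hmh.const_mul_atTop (r := (η / 2) ^ 3) (by positivity)).congr fun n => by ring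
  obtain ⟨c, hc, hblock⟩ :=
    hA1.exists_eventually_hasLargeBlock hd₀ hf hder hf' hx hx_mono hr hr0 hmr
  have hbound : Tendsto (fun n => 4 * Var[id; ρ] / (c * (m n * r n) * (f' / 4 * r n / 3) ^ 2))
      atTop (𝓝 0) :=
    tendsto_const_nhds.div_atTop ((hmr.const_mul_atTop
      (r := c * (f' / 12) ^ 2) (by positivity)).congr fun n => by ring)
  refine squeeze_zero' (.of_forall fun n => measureReal_nonneg) ?_ hbound
  filter_upwards [hblock, hh0, hmr.eventually_gt_atTop 0] with n hblock hhn hmrn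
  have hm : (0 : ℝ) < m n := pos_of_mul_pos_left hmrn (by positivity)
  have hceil : 0 < ⌈c * (m n * r n)⌉₊ := Nat.ceil_pos.2 (by positivity)
  calc P.real {ω | η ≤ ‖(inverseAt (fhat n ω) (f d₀) - d₀) / h n - 0‖}
      ≤ P.real {ω | HasLargeBlock (m n) (x n) (fun i => ε n i ω) d₀ (f' / 4 * r n / 3)
          ⌈c * (m n * r n)⌉₊} := measureReal_mono fun ω hω => hblock _ _ (hfhat n ω) <| by
        rw [Set.mem_ofPred_eq, sub_zero, norm_div, Real.norm_of_nonneg hhn.le,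
          le_div_iff₀ hhn, Real.norm_eq_abs] at hω
        exact hω.trans_lt' (mul_lt_mul_of_pos_right (half_lt_self hη) hhn)
    _ ≤ 4 * Var[id; ρ] / (⌈c * (m n * r n)⌉₊ * (f' / 4 * r n / 3) ^ 2) :=
        measureReal_hasLargeBlock_le (hlaw n) (hind n) hL2 hmean hceil.ne' (by positivity) _ _
    _ ≤ 4 * Var[id; ρ] / (c * (m n * r n) * (f' / 4 * r n / 3) ^ 2) := by
        gcongr
        · exact mul_nonneg four_pos.le (variance_nonneg _ _)
        · exact Nat.le_ceil _

end Design

/-! ### From sequences to convergence in measure -/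

theorem tendstoInMeasure_prodMk {α ι E F : Type*} {_ : MeasurableSpace α} {μ : Measure α}
    [PseudoEMetricSpace E] [PseudoEMetricSpace F] {l : Filter ι} {f : ι → α → E} {f₀ : α → E}
    {g : ι → α → F} {g₀ : α → F} (hf : TendstoInMeasure μ f l f₀)
    (hg : TendstoInMeasure μ g l g₀) :
    TendstoInMeasure μ (fun i a => (f i a, g i a)) l fun a => (f₀ a, g₀ a) := by
  intro η hη
  refine tendsto_of_tendsto_of_tendsto_of_le_of_le tendsto_const_nhds
    (by simpa using (hf η hη).add (hg η hη)) (fun _ => zero_le) fun i => ?_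
  refine (measure_mono fun a (ha : η ≤ edist (f i a, g i a) (f₀ a, g₀ a)) => ?_).trans
    (measure_union_le _ _)
  exact le_max_iff.1 ha

theorem tendstoInMeasure_of_forall_seq {Ω E F : Type*} {_ : MeasurableSpace Ω} {P : Measure Ω}
    [PseudoEMetricSpace E] [PseudoEMetricSpace F] {T : ℕ → Ω → E} {c : E} {D : ℕ → Ω → F} {z : F}
    {q : ℕ → Prop} (hT : TendstoInMeasure P T atTop fun _ => c) (hq : ∀ᶠ n in atTop, q n)
    (hD : ∀ (N : ℕ → ℕ) (ω : ℕ → Ω), (∀ k, q (N k)) → Tendsto N atTop atTop →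
      Tendsto (fun k => T (N k) (ω k)) atTop (𝓝 c) →
      Tendsto (fun k => D (N k) (ω k)) atTop (𝓝 z)) :
    TendstoInMeasure P D atTop fun _ => z := by
  have hlim : Tendsto (fun a : ℕ × Ω => D a.1 a.2)
      (comap Prod.fst atTop ⊓ comap (fun a => T a.1 a.2) (𝓝 c)) (𝓝 z) := by
    refine tendsto_of_seq_tendsto fun u hu => ?_
    rw [tendsto_inf, tendsto_comap_iff, tendsto_comap_iff] at hu
    obtain ⟨K, hK⟩ := eventually_atTop.1 (hu.1.eventually hq)
    rw [← tendsto_add_atTop_iff_nat K]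
    exact hD _ _ (fun k => hK _ (Nat.le_add_left K k)) (hu.1.comp (tendsto_add_atTop_nat K))
      (hu.2.comp (tendsto_add_atTop_nat K))
  intro η hη
  obtain ⟨s, hs, t, ht, hst⟩ := mem_inf_iff_superset.1 (hlim (Metric.eball_mem_nhds z hη))
  obtain ⟨s', hs', hss'⟩ := mem_comap.1 hs
  obtain ⟨t', ht', htt'⟩ := mem_comap.1 ht
  obtain ⟨δ, hδ, hδt'⟩ := EMetric.mem_nhds_iff.1 ht'
  refine tendsto_of_tendsto_of_tendsto_of_le_of_le' tendsto_const_nhds (hT δ hδ)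
    (.of_forall fun _ => zero_le) ?_
  filter_upwards [hs'] with n hn
  refine measure_mono fun ω (hω : η ≤ edist (D n ω) z) => ?_
  by_contra hfar
  have hnear : edist (T n ω) c < δ := not_le.1 hfar
  have hmem : (n, ω) ∈ s ∩ t := ⟨hss' hn, htt' (hδt' hnear)⟩
  have hclose : edist (D n ω) z < η := hst hmem
  exact hclose.not_ge hω

/-! ### The second stage -/

theorem sampleMean_const_add {m : ℕ} [NeZero m] (a : ℝ) (e : Fin m → ℝ) :
    sampleMean (fun i => a + e i) = a + sampleMean e := by
  rw [sampleMean_eq_add _ a, sampleMean]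
  simp only [add_sub_cancel_left]

theorem sampleVar_const_add {m : ℕ} [NeZero m] (a : ℝ) (e : Fin m → ℝ) :
    sampleVar (fun i => a + e i) = sampleMean (fun i => e i ^ 2) - sampleMean e ^ 2 := by
  have hm : (m : ℝ) ≠ 0 := NeZero.ne _
  have hsum : ∀ y : Fin m → ℝ, ∑ i, y i = m * sampleMean y := fun y => by
    rw [sampleMean, mul_inv_cancel_left₀ hm]
  rw [sampleVar, sampleMean_const_add]
  simp only [add_sub_add_left_eq_sub, sub_sq, Finset.sum_add_distrib, Finset.sum_sub_distrib,
    ← Finset.sum_mul, ← Finset.mul_sum, hsum e, hsum fun i => e i ^ 2, Finset.sum_const,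
    Finset.card_univ, Fintype.card_fin, nsmul_eq_mul]
  field_simp
  ring

theorem abs_sampleMean_le_norm {m : ℕ} (e : Fin m → ℝ) : |sampleMean e| ≤ ‖e‖ := by
  have hsum : |∑ i, e i| ≤ m * ‖e‖ := by
    simpa using (Finset.abs_sum_le_sum_abs e Finset.univ).trans
      (Finset.sum_le_card_nsmul _ _ _ fun i _ => norm_le_pi_norm e i)
  rw [sampleMean, abs_mul, abs_of_nonneg (by positivity)]
  exact inv_mul_le_of_le_mul₀ (by positivity) (norm_nonneg e) hsum

theorem sampleMaxDev_const_add_le {m : ℕ} [NeZero m] (a : ℝ) (e : Fin m → ℝ) :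
    sampleMaxDev (fun i => a + e i) ≤ 2 * ‖e‖ := by
  rw [sampleMaxDev, sampleMean_const_add]
  simp only [add_sub_add_left_eq_sub]
  calc ‖e - fun _ => sampleMean e‖ ≤ ‖e‖ + ‖fun _ : Fin m => sampleMean e‖ := norm_sub_le _ _
    _ ≤ ‖e‖ + ‖e‖ := by
      gcongr
      exact (pi_norm_const_le _).trans (abs_sampleMean_le_norm e)
    _ = 2 * ‖e‖ := (two_mul _).symm

/-- The statistics of an error sample that decide the limit of the bootstrap distribution: its mean
relative to the half-width `h`, its second moment, and its maximum relative to the root of its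
size. -/
noncomputable def errorStats {m : ℕ} (h : ℝ) (e : Fin m → ℝ) : ℝ × ℝ × ℝ :=
  (sampleMean e / h, sampleMean fun i => e i ^ 2, ‖e‖ / √m)

section Deterministic

variable {m : ℕ → ℕ} [∀ k, NeZero (m k)] {h : ℕ → ℝ} {v : ℝ}

theorem tendsto_sampleVar_const_add {e : (k : ℕ) → Fin (m k) → ℝ} (hh : Tendsto h atTop (𝓝 0))
    (hh0 : ∀ᶠ k in atTop, h k ≠ 0)
    (he : Tendsto (fun k => errorStats (h k) (e k)) atTop (𝓝 (0, v, 0))) (a : ℕ → ℝ) :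
    Tendsto (fun k => sampleVar fun i => a k + e k i) atTop (𝓝 v) := by
  have hmean : Tendsto (fun k => sampleMean (e k)) atTop (𝓝 0) := by
    have hmul := he.fst_nhds.mul hh
    rw [mul_zero] at hmul
    exact hmul.congr' (hh0.mono fun k hk => div_mul_cancel₀ _ hk)
  have hlim := he.snd_nhds.fst_nhds.sub (hmean.pow 2)
  rw [zero_pow two_ne_zero, sub_zero] at hlim
  exact hlim.congr fun k => (sampleVar_const_add _ _).symm

theorem tendsto_sampleMaxDev_const_add {e : (k : ℕ) → Fin (m k) → ℝ}
    (he : Tendsto (fun k => errorStats (h k) (e k)) atTop (𝓝 (0, v, 0))) (a : ℕ → ℝ) :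
    Tendsto (fun k => sampleMaxDev (fun i => a k + e k i) / √(m k)) atTop (𝓝 0) := by
  have hlim := he.snd_nhds.snd_nhds.const_mul 2
  rw [mul_zero] at hlim
  refine squeeze_zero (fun k => div_nonneg (norm_nonneg _) (Real.sqrt_nonneg _)) (fun k => ?_) hlim
  rw [errorStats, ← mul_div_assoc]
  gcongr
  exact sampleMaxDev_const_add_le _ _

theorem stageTwoRegular_const_add {f : ℝ → ℝ} {f' d₀ : ℝ} {d : ℕ → ℝ}
    {e' e'' : (k : ℕ) → Fin (m k) → ℝ} (hder : HasDerivAt f f' d₀) (hh : Tendsto h atTop (𝓝 0))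
    (hh0 : ∀ᶠ k in atTop, h k ≠ 0) (hd : Tendsto (fun k => (d k - d₀) / h k) atTop (𝓝 0))
    (he' : Tendsto (fun k => errorStats (h k) (e' k)) atTop (𝓝 (0, v, 0)))
    (he'' : Tendsto (fun k => errorStats (h k) (e'' k)) atTop (𝓝 (0, v, 0))) :
    StageTwoRegular (fun k i => f (d k - h k) + e' k i) (fun k i => f (d k + h k) + e'' k i) h
      (f d₀) f' v := by
  have hquot : ∀ s : ℝ,
      Tendsto (fun k => (f (d k + s * h k) - f d₀) / h k) atTop (𝓝 (s * f')) := by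
    intro s
    have hc := hd.add_const s
    rw [zero_add] at hc
    refine (tendsto_sub_div_of_hasDerivAt hder hh hh0 hc).congr' (hh0.mono fun k hk => ?_)
    congr 3
    field_simp
    ring
  have hL := (hquot (-1)).add he'.fst_nhds
  have hU := (hquot 1).add he''.fst_nhds
  refine ⟨?_, ?_, tendsto_sampleVar_const_add hh hh0 he' _,
    tendsto_sampleVar_const_add hh hh0 he'' _, tendsto_sampleMaxDev_const_add he' _,
    tendsto_sampleMaxDev_const_add he'' _⟩
  · have hslope := (hU.sub hL).div_const 2
    rw [show (1 * f' + 0 - (-1 * f' + 0)) / 2 = f' by ring] at hslope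
    refine hslope.congr' (hh0.mono fun k hk => ?_)
    simp only [lsSlope_eq, sampleMean_const_add, errorStats, one_mul, neg_one_mul,
      ← sub_eq_add_neg]
    field_simp
    ring
  · have hbias := (hL.add hU).div_const (-2)
    rw [show (-1 * f' + 0 + (1 * f' + 0)) / -2 = 0 by ring] at hbias
    refine hbias.congr' (hh0.mono fun k hk => ?_)
    simp only [sampleMean_const_add, errorStats, one_mul, neg_one_mul, ← sub_eq_add_neg]
    field_simp
    ring

end Deterministic

section Errors

variable {Ω : Type*} [MeasurableSpace Ω] {P : Measure Ω} [IsProbabilityMeasure P] {ρ : Measure ℝ}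
  [IsProbabilityMeasure ρ] {m : ℕ → ℕ} {h : ℕ → ℝ}

theorem tendstoInMeasure_errorStats {X : ℕ → ℕ → Ω → ℝ}
    (hlaw : ∀ n, ∀ i < m n, HasLaw (X n i) ρ P)
    (hind : ∀ n, iIndepFun (fun i : Fin (m n) => X n i) P) (hL2 : MemLp id 2 ρ)
    (hmean : ∫ z, z ∂ρ = 0) (hm : Tendsto m atTop atTop) (hh0 : ∀ᶠ n in atTop, 0 < h n)
    (hmh : Tendsto (fun n => m n * h n ^ 2) atTop atTop) :
    TendstoInMeasure P (fun n ω => errorStats (h n) fun i : Fin (m n) => X n i ω) atTop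
      fun _ => (0, ∫ z, z ^ 2 ∂ρ, 0) := by
  have hsq : TendstoInMeasure P (fun n ω => sampleMean fun i : Fin (m n) => X n i ω ^ 2) atTop
      fun _ => ∫ z, z ^ 2 ∂ρ :=
    tendstoInMeasure_sampleMean_comp (φ := fun z => z ^ 2) hlaw hind hm (by fun_prop)
      hL2.integrable_sq
  exact tendstoInMeasure_prodMk (tendstoInMeasure_sampleMean_div hlaw hind hL2 hmean hh0 hmh)
    (tendstoInMeasure_prodMk hsq (tendstoInMeasure_norm_div_sqrt hlaw hm hL2))

theorem tendstoInMeasure_iSup_bootstrapCDF_sub {f : ℝ → ℝ} {f' d₀ R : ℝ}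
    {dhat : ℕ → Ω → ℝ} {ε' ε'' : ℕ → ℕ → Ω → ℝ} (hder : HasDerivAt f f' d₀) (hf' : 0 < f')
    (hL2 : MemLp id 2 ρ) (hmean : ∫ z, z ∂ρ = 0)
    (hlaw' : ∀ n, ∀ i < m n, HasLaw (ε' n i) ρ P) (hlaw'' : ∀ n, ∀ i < m n, HasLaw (ε'' n i) ρ P)
    (hind' : ∀ n, iIndepFun (fun i : Fin (m n) => ε' n i) P)
    (hind'' : ∀ n, iIndepFun (fun i : Fin (m n) => ε'' n i) P)
    (hm : Tendsto m atTop atTop) (hR : Tendsto (fun n : ℕ => (n : ℝ) / m n) atTop (𝓝 R))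
    (hRV : 0 < R * ∫ z, z ^ 2 ∂ρ) (hh : Tendsto h atTop (𝓝 0)) (hh0 : ∀ᶠ n in atTop, 0 < h n)
    (hmh : Tendsto (fun n => m n * h n ^ 2) atTop atTop)
    (hnh : Tendsto (fun n : ℕ => √(n : ℝ) * h n) atTop atTop)
    (hdhat : TendstoInMeasure P (fun n ω => (dhat n ω - d₀) / h n) atTop fun _ => 0) :
    TendstoInMeasure P (fun n ω => ⨆ t, |bootstrapCDF n (f d₀) (dhat n ω) (h n)
        (fun i : Fin (m n) => f (dhat n ω - h n) + ε' n i ω)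
        (fun i : Fin (m n) => f (dhat n ω + h n) + ε'' n i ω) t
      - (gaussianReal 0 (R / (2 * f' ^ 2) * ∫ z, z ^ 2 ∂ρ).toNNReal).real (Set.Iic t)|) atTop
      fun _ => 0 := by
  refine tendstoInMeasure_of_forall_seq
    (tendstoInMeasure_prodMk hdhat (tendstoInMeasure_prodMk
      (tendstoInMeasure_errorStats hlaw' hind' hL2 hmean hm hh0 hmh)
      (tendstoInMeasure_errorStats hlaw'' hind'' hL2 hmean hm hh0 hmh)))
    (hm.eventually_ne_atTop 0) fun N ω hmN hN hstats => ?_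
  have : ∀ k, NeZero (m (N k)) := fun k => ⟨hmN k⟩
  have hreg := stageTwoRegular_const_add hder (hh.comp hN)
    ((hN.eventually hh0).mono fun _ hk => hk.ne') hstats.fst_nhds hstats.snd_nhds.fst_nhds
    hstats.snd_nhds.snd_nhds
  exact hreg.tendsto_iSup_bootstrapCDF_sub hf' (hR.comp hN) hRV (hnh.comp hN) _

end Errors

/-! ### Sample sizes and half-widths -/

theorem stageOneSize_le {p : ℝ} (hp1 : p < 1) (n : ℕ) : stageOneSize p n ≤ n := by
  have := stageOneSize_add_two_mul p hp1 n
  omega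

theorem stageTwoSize_le {p : ℝ} (hp1 : p < 1) (n : ℕ) : stageTwoSize p n ≤ n := by
  have := stageOneSize_add_two_mul p hp1 n
  omega

theorem abs_stageOneSize_sub_le {p : ℝ} (hp0 : 0 ≤ p) (n : ℕ) :
    |(stageOneSize p n : ℝ) - n * p| ≤ 1 := by
  have hfloor : (⌊(n : ℝ) * p⌋₊ : ℝ) ≤ n * p := Nat.floor_le (by positivity)
  have hlt : (n : ℝ) * p < ⌊(n : ℝ) * p⌋₊ + 1 := Nat.lt_floor_add_one _
  rw [abs_le]
  unfold stageOneSize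
  split_ifs
  · constructor <;> linarith
  · push_cast
    constructor <;> linarith

theorem tendsto_stageOneSize_div {p : ℝ} (hp0 : 0 ≤ p) :
    Tendsto (fun n : ℕ => (stageOneSize p n : ℝ) / n) atTop (𝓝 p) := by
  have herr : Tendsto (fun n : ℕ => ((stageOneSize p n : ℝ) - n * p) / n) atTop (𝓝 0) := by
    refine squeeze_zero_norm (fun n => ?_) tendsto_one_div_atTop_nhds_zero_nat
    rw [norm_div, Real.norm_natCast]
    gcongr
    exact abs_stageOneSize_sub_le hp0 n
  have hlim := herr.add_const p
  rw [zero_add] at hlim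
  refine hlim.congr' ?_
  filter_upwards [eventually_ne_atTop 0] with n hn
  field_simp
  ring

theorem tendsto_stageTwoSize_div {p : ℝ} (hp0 : 0 ≤ p) (hp1 : p < 1) :
    Tendsto (fun n : ℕ => (stageTwoSize p n : ℝ) / n) atTop (𝓝 ((1 - p) / 2)) := by
  refine (((tendsto_stageOneSize_div hp0).const_sub 1).div_const 2).congr' ?_
  filter_upwards [eventually_ne_atTop 0] with n hn
  have hsum : (stageOneSize p n : ℝ) + 2 * stageTwoSize p n = n := by
    exact_mod_cast stageOneSize_add_two_mul p hp1 n
  field_simp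
  linarith

theorem tendsto_atTop_of_tendsto_div_natCast {m : ℕ → ℕ} {r : ℝ} (hr : 0 < r)
    (h : Tendsto (fun n : ℕ => (m n : ℝ) / n) atTop (𝓝 r)) : Tendsto m atTop atTop := by
  rw [← tendsto_natCast_atTop_iff (R := ℝ)]
  refine (h.pos_mul_atTop hr tendsto_natCast_atTop_atTop).congr' ?_
  filter_upwards [eventually_ne_atTop 0] with n hn
  field_simp

theorem tendsto_stageOneSize {p : ℝ} (hp0 : 0 < p) : Tendsto (stageOneSize p) atTop atTop :=
  tendsto_atTop_of_tendsto_div_natCast hp0 (tendsto_stageOneSize_div hp0.le)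

theorem tendsto_stageTwoSize {p : ℝ} (hp0 : 0 ≤ p) (hp1 : p < 1) :
    Tendsto (stageTwoSize p) atTop atTop :=
  tendsto_atTop_of_tendsto_div_natCast (half_pos (sub_pos.2 hp1)) (tendsto_stageTwoSize_div hp0 hp1)

theorem tendsto_div_stageTwoSize {p : ℝ} (hp0 : 0 ≤ p) (hp1 : p < 1) :
    Tendsto (fun n : ℕ => (n : ℝ) / stageTwoSize p n) atTop (𝓝 (2 / (1 - p))) := by
  simpa only [inv_div] using
    (tendsto_stageTwoSize_div hp0 hp1).inv₀ (half_pos (sub_pos.2 hp1)).ne'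

section HalfWidth

variable {ι : Type*} {l : Filter ι} {u : ι → ℝ} {K γ : ℝ}

theorem tendsto_const_mul_rpow_neg (hu : Tendsto u l atTop) (hγ : 0 < γ) :
    Tendsto (fun i => K * u i ^ (-γ)) l (𝓝 0) := by
  simpa using ((tendsto_rpow_neg_atTop hγ).comp hu).const_mul K

theorem eventually_const_mul_rpow_pos (hu : Tendsto u l atTop) (hK : 0 < K) :
    ∀ᶠ i in l, 0 < K * u i ^ (-γ) := by
  filter_upwards [hu.eventually_gt_atTop 0] with i hi
  positivity

theorem tendsto_mul_const_mul_rpow_neg_pow (hu : Tendsto u l atTop) (hK : 0 < K) {k : ℕ}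
    (hk : k * γ < 1) : Tendsto (fun i => u i * (K * u i ^ (-γ)) ^ k) l atTop := by
  have hpow := ((tendsto_rpow_atTop (y := 1 - k * γ) (by linarith)).comp hu).const_mul_atTop
    (pow_pos hK k)
  refine hpow.congr' ?_
  filter_upwards [hu.eventually_gt_atTop 0] with i hi
  rw [mul_pow, ← Real.rpow_mul_natCast hi.le, Function.comp, sub_eq_add_neg, Real.rpow_add hi,
    Real.rpow_one]
  ring_nf

end HalfWidth

theorem tendsto_sqrt_natCast_mul {m : ℕ → ℕ} {h : ℕ → ℝ} (hle : ∀ n, m n ≤ n)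
    (hh0 : ∀ᶠ n in atTop, 0 < h n) (hmh : Tendsto (fun n => m n * h n ^ 2) atTop atTop) :
    Tendsto (fun n : ℕ => √(n : ℝ) * h n) atTop atTop := by
  refine tendsto_atTop_mono' _ ?_ (Real.tendsto_sqrt_atTop.comp hmh)
  filter_upwards [hh0] with n hn
  rw [Function.comp, Real.sqrt_mul (Nat.cast_nonneg _), Real.sqrt_sq hn.le]
  gcongr
  exact hle n

theorem tendsto_stageTwoSize_mul {p : ℝ} (hp : p ∈ Set.Ioo (0 : ℝ) 1) {w : ℕ → ℝ}
    (hw : Tendsto (fun n => stageOneSize p n * w n) atTop atTop) :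
    Tendsto (fun n => stageTwoSize p n * w n) atTop atTop := by
  have hratio := (tendsto_stageTwoSize_div hp.1.le hp.2).div (tendsto_stageOneSize_div hp.1.le)
    hp.1.ne'
  have hpos : 0 < (1 - p) / 2 / p := div_pos (by linarith [hp.2]) hp.1
  refine (hratio.pos_mul_atTop hpos hw).congr' ?_
  filter_upwards [(tendsto_stageOneSize hp.1).eventually_ne_atTop 0, eventually_ne_atTop 0]
    with n hmn hn
  rw [Pi.div_apply]
  field_simp

/-! ### The limit theorem -/

theorem real_gaussianReal_mul_le (C t : ℝ) :
    (gaussianReal 0 1).real {z | C * z ≤ t}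
      = (gaussianReal 0 (C ^ 2).toNNReal).real (Set.Iic t) := by
  have hmap := gaussianReal_map_const_mul (μ := 0) (v := 1) C
  rw [mul_zero, mul_one, ← Real.toNNReal_of_nonneg (sq_nonneg C)] at hmap
  rw [← hmap, map_measureReal_apply (by fun_prop) measurableSet_Iic]
  rfl

theorem theorem4_general {Ω : Type*} [MeasurableSpace Ω] (P : Measure Ω) [IsProbabilityMeasure P]
    (d₀ : ℝ) (hd₀ : d₀ ∈ Set.Ioo (0 : ℝ) 1) (f : ℝ → ℝ) (hf : MonotoneOn f (Set.Icc 0 1))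
    (f' : ℝ) (hder : HasDerivAt f f' d₀) (hf' : 0 < f')
    (p K γ : ℝ) (hp : p ∈ Set.Ioo (0 : ℝ) 1) (hK : 0 < K) (hγ : γ ∈ Set.Ioo (0 : ℝ) (1 / 3))
    (x : ℕ → ℕ → ℝ)
    (hx : ∀ n, ∀ i < stageOneSize p n, x n i ∈ Set.Icc (0 : ℝ) 1)
    (hx_mono : ∀ n, StrictMonoOn (x n) (Set.Iio (stageOneSize p n)))
    (hA1 : DesignA1 (stageOneSize p) x d₀)
    (ρ : Measure ℝ) [IsProbabilityMeasure ρ] (σ : ℝ) (hσ : 0 < σ)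
    (hmean : ∫ e, e ∂ρ = 0) (hvar : ∫ e, e ^ 2 ∂ρ = σ ^ 2)
    (ε ε' ε'' : ℕ → ℕ → Ω → ℝ)
    (hlaw : ∀ n, ∀ i < n, HasLaw (ε n i) ρ P ∧ HasLaw (ε' n i) ρ P ∧ HasLaw (ε'' n i) ρ P)
    (hind : ∀ n, iIndepFun (fun i : Fin n => ε n i) P)
    (hind' : ∀ n, iIndepFun (fun i : Fin n => ε' n i) P)
    (hind'' : ∀ n, iIndepFun (fun i : Fin n => ε'' n i) P)
    (fhat : ℕ → Ω → ℝ → ℝ)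
    (hfhat : ∀ n ω, IsIsotonicRegression (stageOneSize p n) (x n)
      (fun i => f (x n i) + ε n i ω) (fhat n ω))
    (dhat : ℕ → Ω → ℝ) (hdhat : ∀ n ω, dhat n ω = inverseAt (fhat n ω) (f d₀))
    (h : ℕ → ℝ) (hh : ∀ n, h n = K * (stageOneSize p n : ℝ) ^ (-γ))
    (Y' Y'' : (n : ℕ) → Ω → Fin (stageTwoSize p n) → ℝ)
    (hY' : ∀ n ω i, Y' n ω i = f (dhat n ω - h n) + ε' n i ω)
    (hY'' : ∀ n ω i, Y'' n ω i = f (dhat n ω + h n) + ε'' n i ω)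
    (C₂ : ℝ) (hC₂ : C₂ = σ / (f' * (1 - p) ^ (1 / 2 : ℝ))) :
    TendstoInMeasure P
      (fun n ω => ⨆ t : ℝ,
        |bootstrapCDF n (f d₀) (dhat n ω) (h n) (Y' n ω) (Y'' n ω) t
          - (gaussianReal 0 1).real {z | C₂ * z ≤ t}|)
      atTop (fun _ => 0) := by
  obtain rfl : dhat = fun n ω => inverseAt (fhat n ω) (f d₀) := by ext; exact hdhat ..
  obtain rfl : Y' = fun n ω (i : Fin (stageTwoSize p n)) =>
      f (inverseAt (fhat n ω) (f d₀) - h n) + ε' n i ω := by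
    ext; exact hY' ..
  obtain rfl : Y'' = fun n ω (i : Fin (stageTwoSize p n)) =>
      f (inverseAt (fhat n ω) (f d₀) + h n) + ε'' n i ω := by
    ext; exact hY'' ..
  obtain rfl : h = fun n => K * (stageOneSize p n : ℝ) ^ (-γ) := funext hh
  have hp1 : 0 < 1 - p := sub_pos.2 hp.2
  have hL2 : MemLp id 2 ρ := (memLp_two_iff_integrable_sq aestronglyMeasurable_id).2
    (.of_integral_ne_zero (by simpa [hvar] using hσ.ne'))
  have hm₁ : Tendsto (fun n => (stageOneSize p n : ℝ)) atTop atTop :=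
    tendsto_natCast_atTop_iff.2 (tendsto_stageOneSize hp.1)
  have hh_lim := tendsto_const_mul_rpow_neg (K := K) hm₁ hγ.1
  have hh0 : ∀ᶠ n in atTop, 0 < K * (stageOneSize p n : ℝ) ^ (-γ) :=
    eventually_const_mul_rpow_pos hm₁ hK
  have hmh₂ : Tendsto (fun n => stageOneSize p n * (K * (stageOneSize p n : ℝ) ^ (-γ)) ^ 2) atTop
      atTop :=
    tendsto_mul_const_mul_rpow_neg_pow hm₁ hK (by push_cast; linarith [hγ.2])
  have hmh₃ : Tendsto (fun n => stageOneSize p n * (K * (stageOneSize p n : ℝ) ^ (-γ)) ^ 3) atTop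
      atTop :=
    tendsto_mul_const_mul_rpow_neg_pow hm₁ hK (by push_cast; linarith [hγ.2])
  have hle₁ := stageOneSize_le hp.2
  have hle₂ := stageTwoSize_le hp.2
  have hC : C₂ ^ 2 = 2 / (1 - p) / (2 * f' ^ 2) * ∫ e, e ^ 2 ∂ρ := by
    rw [hC₂, hvar, div_pow, mul_pow, ← Real.sqrt_eq_rpow, Real.sq_sqrt hp1.le]
    field_simp
  simp only [real_gaussianReal_mul_le, hC]
  refine tendstoInMeasure_iSup_bootstrapCDF_sub hder hf' hL2 hmean
    (fun n i hi => (hlaw n i (hi.trans_le (hle₂ n))).2.1)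
    (fun n i hi => (hlaw n i (hi.trans_le (hle₂ n))).2.2)
    (fun n => (hind' n).precomp (g := Fin.castLE (hle₂ n)) (Fin.castLE_injective _))
    (fun n => (hind'' n).precomp (g := Fin.castLE (hle₂ n)) (Fin.castLE_injective _))
    (tendsto_stageTwoSize hp.1.le hp.2) (tendsto_div_stageTwoSize hp.1.le hp.2)
    (by rw [hvar]; positivity) hh_lim hh0
    (tendsto_stageTwoSize_mul hp hmh₂) (tendsto_sqrt_natCast_mul hle₁ hh0 hmh₂) ?_
  exact tendstoInMeasure_inverseAt_sub_div hA1 hd₀ hf hder hf' hx hx_mono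
    (fun n i hi => (hlaw n i (hi.trans_le (hle₁ n))).1)
    (fun n => (hind n).precomp (g := Fin.castLE (hle₁ n)) (Fin.castLE_injective _))
    hL2 hmean hfhat hh_lim hh0 hmh₃

theorem theorem4 {Ω : Type*} [MeasurableSpace Ω] (P : Measure Ω) [IsProbabilityMeasure P]
    -- regression function and target
    (d₀ : ℝ) (hd₀ : d₀ ∈ Set.Ioo (0 : ℝ) 1) (f : ℝ → ℝ) (hf : ClassF d₀ f)
    -- tuning parameters
    (p K γ : ℝ) (hp : p ∈ Set.Ioo (0 : ℝ) 1) (hK : 0 < K) (hγ : γ ∈ Set.Ioo (0 : ℝ) (1 / 3))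
    -- first-stage design: row `n` has `n₁ = stageOneSize p n` increasing points in `[0,1]`
    (x : ℕ → ℕ → ℝ)
    (hx : ∀ n, ∀ i < stageOneSize p n, x n i ∈ Set.Icc (0 : ℝ) 1)
    (hx_mono : ∀ n, StrictMonoOn (x n) (Set.Iio (stageOneSize p n)))
    (hA1 : DesignA1 (stageOneSize p) x d₀)
    -- law of the errors: mean zero, variance `σ² > 0`, finite sixth moment
    (ρ : Measure ℝ) [IsProbabilityMeasure ρ] (σ : ℝ) (hσ : 0 < σ)
    (hA5 : Integrable (fun e => e ^ 6) ρ)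
    (hmean : ∫ e, e ∂ρ = 0) (hvar : ∫ e, e ^ 2 ∂ρ = σ ^ 2)
    -- triangular arrays of errors, independent within each row and all with law `ρ`
    (ε ε' ε'' : ℕ → ℕ → Ω → ℝ)
    (hlaw : ∀ n, ∀ i < n, HasLaw (ε n i) ρ P ∧ HasLaw (ε' n i) ρ P ∧ HasLaw (ε'' n i) ρ P)
    (hindep : ∀ n, iIndepFun
      (Sum.elim (fun i : Fin n => ε n i)
        (Sum.elim (fun i : Fin n => ε' n i) (fun i : Fin n => ε'' n i))) P)
    -- isotonic regression of the first-stage data, and first-stage estimate of `d₀`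
    (fhat : ℕ → Ω → ℝ → ℝ)
    (hfhat : ∀ n ω, IsIsotonicRegression (stageOneSize p n) (x n)
      (fun i => f (x n i) + ε n i ω) (fhat n ω))
    (dhat : ℕ → Ω → ℝ) (hdhat : ∀ n ω, dhat n ω = inverseAt (fhat n ω) (f d₀))
    -- half-width of the second-stage interval
    (h : ℕ → ℝ) (hh : ∀ n, h n = K * (stageOneSize p n : ℝ) ^ (-γ))
    -- second-stage responses at `L = dhat - h` and `U = dhat + h`
    (Y' Y'' : (n : ℕ) → Ω → Fin (stageTwoSize p n) → ℝ)
    (hY' : ∀ n ω i, Y' n ω i = f (dhat n ω - h n) + ε' n i ω)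
    (hY'' : ∀ n ω i, Y'' n ω i = f (dhat n ω + h n) + ε'' n i ω)
    -- the constant `C₂`
    (C₂ : ℝ) (hC₂ : C₂ = σ / (deriv f d₀ * (1 - p) ^ (1 / 2 : ℝ))) :
    TendstoInMeasure P
      (fun n ω => ⨆ t : ℝ,
        |bootstrapCDF n (f d₀) (dhat n ω) (h n) (Y' n ω) (Y'' n ω) t
          - (gaussianReal 0 1).real {z | C₂ * z ≤ t}|)
      atTop (fun _ => 0) :=
  theorem4_general P d₀ hd₀ f hf.1.1 _ hf.1.2.self_of_nhds.1.hasDerivAt hf.1.2.self_of_nhds.2.1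
    p K γ hp hK hγ x hx hx_mono hA1 ρ σ hσ hmean hvar ε ε' ε'' hlaw
    (fun n => (hindep n).precomp Sum.inl_injective)
    (fun n => (hindep n).precomp (Sum.inr_injective.comp Sum.inl_injective))
    (fun n => (hindep n).precomp (Sum.inr_injective.comp Sum.inr_injective))
    fhat hfhat dhat hdhat h hh Y' Y'' hY' hY'' C₂ hC₂
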